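/- All graphs are finite and simple. A graph $G$ is $(a,b)$-Ramsey if every colouring of its edges in red and blue contains a red copy of $K_a$ or a blue copy of $K_b$. Let $r(a,b)$ be the least $n$ such that $K_n$ is $(a,b)$-Ramsey, and for a graph $F$ let $r_F(a,b)$ be the least number of copies of $F$ (subgraphs isomorphic to $F$) contained in an $(a,b)$-Ramsey graph. For real $x$ and an integer $s\ge 0$ let $\binom{x}{s}=\frac{x(x-1)\cdots(x-s+1)}{s!}$. 1. There is an absolute constant $c>0$ such that for all integers $t\ge 2$ and $0\le s\le t$ there is a real number $x\ge \max\left(s,\; c\,\frac{t^2}{\log^2 t}\right)$ such that every $(3,t)$-Ramsey graph contains at least $\binom{x}{s}$ copies of $K_s$, and $$r_{K_s}(3,t)=\binom{x}{s}.$$ That is, $r_{K_s}(3,t)=\binom{\Omega(t^2/\log^2 t)}{s}$ for all $s\le t$, with an absolute implicit constant. 2. Consequently $r_{K_s}(3,t)=\binom{r(3,t)}{s}^{1-o(1)}$ for all $s\le t$, where the $o(1)$ tends to $0$ as $t\to\infty$, uniformly in $s$. Precisely, there is a function $\delta$ with $\delta(t)\to 0$ as $t\to\infty$ such that for all integers $0\le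 s\le t$ there is a real $\varepsilon$ with $|\varepsilon|\le\delta(t)$ and $r_{K_s}(3,t)=\binom{r(3,t)}{s}^{1-\varepsilon}$. -/

import Mathlib

open Filter Topology

/-- `G` is `(a, b)`-Ramsey: for every colouring of its edges in red and blue (`R` is the graph of red
edges, `G \ R` the graph of blue edges) there is a red copy of `K_a` or a blue copy of `K_b`. -/
def IsRamsey {V : Type*} (G : SimpleGraph V) (a b : ℕ) : Prop :=
  ∀ R : SimpleGraph V, R ≤ G → ¬ R.CliqueFree a ∨ ¬ (G \ R).CliqueFree b

/-- The Ramsey number `r(a, b)`: the least `n` such that `K_n` is `(a, b)`-Ramsey. -/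
noncomputable def ramseyNumber (a b : ℕ) : ℕ :=
  sInf {n : ℕ | IsRamsey (⊤ : SimpleGraph (Fin n)) a b}

/-- The `F`-Ramsey number `r_F(a, b)`: the least number of copies of `F` (subgraphs isomorphic
to `F`) in a finite `(a, b)`-Ramsey graph. -/
noncomputable def graphRamseyNumber {W : Type*} (F : SimpleGraph W) (a b : ℕ) : ℕ :=
  sInf {N : ℕ | ∃ (n : ℕ) (G : SimpleGraph (Fin n)), IsRamsey G a b ∧ G.copyCount F = N}

/-- The binomial coefficient `x (x - 1) ⋯ (x - s + 1) / s!` for real `x`. -/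
noncomputable def realChoose (x : ℝ) (s : ℕ) : ℝ :=
  (∏ i ∈ Finset.range s, (x - (i : ℝ))) / (s.factorial : ℝ)

/-! Everything reduces to a lower bound for `s = t`. Let `H` be a triangle-free graph on a point set
`P` and `G` a `(3, t)`-Ramsey graph. Map the vertices of `G` to `P` at random and colour red the
edges that land on edges of `H`. No red triangle appears, so some `K_t` is always blue; a fixed
`K_t` is blue with probability at most `I / |P| ^ t`, where `I` counts the independent `t`-tuples of
`H`. Hence `G` has at least `|P| ^ t / I` copies of `K_t` (`le_card_cliqueFinset_of_isRamsey`).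

To make `I` small, take the `q ^ 3` points of `F ^ 3` and the `q ^ 3` lines with directions `(1, a,
a ^ 2)`. Three distinct directions on this conic are linearly independent, so the lines form no
triangles. Put on each line a random complete bipartite graph: the union `H` is triangle-free. A
second-moment estimate for incidences and a union bound over the bipartitions show that in every set
`U` fewer than `n₀ = O(q ^ 2)` points have fewer than `#U / O(q)` neighbours in `U`
(`card_low_degree_lt`). Building independent tuples entry by entry, each entry is one of these `n₀`
points or shrinks the set of candidates by a factor `1 - Ω(1 / q)`, which gives `I ≤ (2 n₀) ^ t *
exp (O(q log² q))` (`card_indepTuples_le`).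

With `q` of order `t / log² t` the last factor is `exp (O(t))`, so there are at least `(Ω(q)) ^ t`
copies of `K_t`, and this exceeds `k.choose t` for some `k` of order `q t`, that is `t² / log² t`.
The Kruskal-Katona theorem passes from `t` to all `s ≤ t` with the same `k`, and continuity in `x`
turns the inequality into an equality. The second claim compares logarithms, using `r(3, t) ≤ t ^
2`. -/

/-! ### A partial geometry on `F ^ 3` -/

section Geometry

open Finset
open scoped Classical

variable {F : Type*} [Field F]

/-- The point `x` of `F ^ 3` lies on the line `l = (a, b, c)`, the line of direction `(1, a, a ^ 2)`
through `(0, b, c)`. -/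
def OnLine (x l : F × F × F) : Prop :=
  x.2.1 = l.1 * x.1 + l.2.1 ∧ x.2.2 = l.1 ^ 2 * x.1 + l.2.2

/-- The line of direction `(1, a, a ^ 2)` through `x`. -/
def lineThrough (x : F × F × F) (a : F) : F × F × F :=
  (a, x.2.1 - a * x.1, x.2.2 - a ^ 2 * x.1)

/-- The point of the line `l` with first coordinate `s`. -/
def pointOn (l : F × F × F) (s : F) : F × F × F :=
  (s, l.1 * s + l.2.1, l.1 ^ 2 * s + l.2.2)

/-- `y - x` is a nonzero multiple of `(1, a, a ^ 2)`. -/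
def CollAlong (a : F) (x y : F × F × F) : Prop :=
  x.1 ≠ y.1 ∧ y.2.1 - x.2.1 = a * (y.1 - x.1) ∧ y.2.2 - x.2.2 = a ^ 2 * (y.1 - x.1)

/-- Two distinct points on a common line. -/
def Coll (x y : F × F × F) : Prop := ∃ a, CollAlong a x y

theorem CollAlong.symm {a : F} {x y : F × F × F} (h : CollAlong a x y) : CollAlong a y x := by
  obtain ⟨h1, h2, h3⟩ := h
  exact ⟨h1.symm, by linear_combination -h2, by linear_combination -h3⟩

theorem Coll.symm {x y : F × F × F} (h : Coll x y) : Coll y x := h.imp fun _ => CollAlong.symm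

theorem coll_comm {x y : F × F × F} : Coll x y ↔ Coll y x := ⟨Coll.symm, Coll.symm⟩

theorem onLine_iff_lineThrough {x l : F × F × F} : OnLine x l ↔ l = lineThrough x l.1 := by
  obtain ⟨a, b, c⟩ := l
  simp only [OnLine, lineThrough, Prod.mk.injEq, true_and]
  constructor
  · rintro ⟨h1, h2⟩
    exact ⟨by rw [h1]; ring, by rw [h2]; ring⟩
  · rintro ⟨h1, h2⟩
    exact ⟨by rw [h1]; ring, by rw [h2]; ring⟩

theorem onLine_iff_pointOn {x l : F × F × F} : OnLine x l ↔ x = pointOn l x.1 := by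
  obtain ⟨a, b, c⟩ := x
  simp [OnLine, pointOn, Prod.mk.injEq]

theorem OnLine.collAlong {x y l : F × F × F} (hx : OnLine x l) (hy : OnLine y l) (h : x ≠ y) :
    CollAlong l.1 x y := by
  refine ⟨fun e => h ?_, ?_, ?_⟩
  · rw [onLine_iff_pointOn.1 hx, onLine_iff_pointOn.1 hy, e]
  · rw [hx.1, hy.1]; ring
  · rw [hx.2, hy.2]; ring

theorem CollAlong.unique {a b : F} {x y : F × F × F} (h : CollAlong a x y) (h' : CollAlong b x y) :
    a = b :=
  mul_right_cancel₀ (sub_ne_zero.2 h.1.symm) (h.2.1.symm.trans h'.2.1)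

/-- There are no triangles. -/
theorem CollAlong.triangle {a b c : F} {x y z : F × F × F} (h1 : CollAlong a x y)
    (h2 : CollAlong b y z) (h3 : CollAlong c x z) : a = b := by
  obtain ⟨h11, h12, h13⟩ := h1
  obtain ⟨h21, h22, h23⟩ := h2
  obtain ⟨h31, h32, h33⟩ := h3
  -- With `u = y.1 - x.1` and `v = z.1 - y.1`, the left side is `(u + v)(a²u + b²v) - (au + bv)²`,
  -- and both terms equal `c²(u + v)²`.
  have e : (y.1 - x.1) * (z.1 - y.1) * (a - b) ^ 2 = 0 := by
    have e2 : a * (y.1 - x.1) + b * (z.1 - y.1) = c * (z.1 - x.1) := by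
      linear_combination -h12 - h22 + h32
    have e3 : a ^ 2 * (y.1 - x.1) + b ^ 2 * (z.1 - y.1) = c ^ 2 * (z.1 - x.1) := by
      linear_combination -h13 - h23 + h33
    linear_combination (z.1 - x.1) * e3 - (a * (y.1 - x.1) + b * (z.1 - y.1)) * e2
      - c * (z.1 - x.1) * e2
  have n1 : y.1 - x.1 ≠ 0 := sub_ne_zero.2 h11.symm
  have n2 : z.1 - y.1 ≠ 0 := sub_ne_zero.2 h21.symm
  have : (a - b) ^ 2 = 0 := by
    rcases mul_eq_zero.1 e with h | h
    · exact absurd h (mul_ne_zero n1 n2)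
    · exact h
  exact sub_eq_zero.1 (pow_eq_zero_iff (two_ne_zero) |>.1 this)

variable [Fintype F]

/-- Absence of triangles decides both cases. If `x` and `y` are collinear, `z` lies on their line
and is fixed by its first coordinate. If not, `z` is fixed by the direction of the line `xz`: two
such points on one line through `x` would form a triangle with `y`. -/
theorem card_coll_coll_le {x y : F × F × F} (hxy : x ≠ y) :
    #{z | Coll x z ∧ Coll z y} ≤ Fintype.card F := by
  by_cases h : Coll x y
  · obtain ⟨a, ha⟩ := h
    have key : ∀ z : F × F × F, Coll x z ∧ Coll z y → CollAlong a x z := by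
      rintro z ⟨⟨b, hb⟩, ⟨c, hc⟩⟩
      have h1 := ha.triangle hc.symm hb
      have h2 := hb.triangle hc ha
      rwa [h1, ← h2]
    refine Finset.card_le_card_of_injOn (t := univ) (fun z => z.1) (fun _ _ => mem_univ _) ?_
    intro z hz w hw e
    simp only [coe_filter, mem_univ, true_and, Set.mem_ofPred_eq] at hz hw
    have e : z.1 = w.1 := e
    have h1 := key z hz
    have h2 := key w hw
    refine Prod.ext e (Prod.ext ?_ ?_)
    · linear_combination h1.2.1 - h2.2.1 + a * e
    · linear_combination h1.2.2 - h2.2.2 + a ^ 2 * e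
  · have hch : ∀ z : F × F × F, ∃ a, Coll x z → CollAlong a x z := fun z => by
      by_cases hz : Coll x z
      · exact hz.imp fun _ h _ => h
      · exact ⟨0, fun h => absurd h hz⟩
    choose f hf using hch
    refine Finset.card_le_card_of_injOn (t := univ) f (fun _ _ => mem_univ _) ?_
    intro z hz w hw e
    simp only [coe_filter, mem_univ, true_and, Set.mem_ofPred_eq] at hz hw
    obtain ⟨hz1, b, hz2⟩ := hz
    obtain ⟨hw1, c, hw2⟩ := hw
    have h1 := hf z hz1
    have h2 := hf w hw1
    rw [← e] at h2
    by_contra hne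
    have hzw1 : z.1 ≠ w.1 := by
      intro e'
      refine hne (Prod.ext e' (Prod.ext ?_ ?_))
      · linear_combination h1.2.1 - h2.2.1 + f z * e'
      · linear_combination h1.2.2 - h2.2.2 + f z ^ 2 * e'
    have hzw : CollAlong (f z) z w :=
      ⟨hzw1, by linear_combination h2.2.1 - h1.2.1, by linear_combination h2.2.2 - h1.2.2⟩
    have hb : f z = b := by
      have := hzw.symm.triangle hz2 hw2
      exact this
    have e1 : y.2.1 - x.2.1 = f z * (y.1 - x.1) := by
      rw [← hb] at hz2; linear_combination hz2.2.1 + h1.2.1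
    have e2 : y.2.2 - x.2.2 = f z ^ 2 * (y.1 - x.1) := by
      rw [← hb] at hz2; linear_combination hz2.2.2 + h1.2.2
    by_cases hx1 : x.1 = y.1
    · refine hxy (Prod.ext hx1 (Prod.ext ?_ ?_))
      · linear_combination -e1 + f z * hx1
      · linear_combination -e2 + f z ^ 2 * hx1
    · exact h ⟨f z, hx1, e1, e2⟩

theorem card_coll (x : F × F × F) :
    #{y | Coll x y} = Fintype.card F * (Fintype.card F - 1) := by
  have : ({y | Coll x y} : Finset (F × F × F)) =
      ((univ : Finset F) ×ˢ (univ.erase x.1 : Finset F)).image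
        (fun p => pointOn (lineThrough x p.1) p.2) := by
    ext y
    simp only [mem_filter, mem_univ, true_and, mem_image, mem_product, mem_erase, Prod.exists,
      and_true]
    constructor
    · rintro ⟨a, h1, h2, h3⟩
      refine ⟨a, y.1, h1.symm, ?_⟩
      refine Prod.ext rfl (Prod.ext ?_ ?_)
      · simp only [pointOn, lineThrough]; linear_combination -h2
      · simp only [pointOn, lineThrough]; linear_combination -h3
    · rintro ⟨a, s, hs, rfl⟩
      exact ⟨a, hs.symm, by simp only [pointOn, lineThrough]; ring,
        by simp only [pointOn, lineThrough]; ring⟩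
  rw [this, card_image_of_injOn, card_product, card_erase_of_mem (mem_univ _), card_univ]
  rintro ⟨a, s⟩ h ⟨b, r⟩ h' e
  simp only [coe_product, Set.mem_prod, mem_coe, mem_erase] at h h'
  simp only [pointOn, lineThrough, Prod.mk.injEq] at e
  obtain ⟨rfl, e2, -⟩ := e
  have : (a - b) * (s - x.1) = 0 := by linear_combination e2
  rcases mul_eq_zero.1 this with h1 | h1
  · rw [sub_eq_zero.1 h1]
  · exact absurd (sub_eq_zero.1 h1) h.2.1

theorem card_lines_through (x : F × F × F) : #{l | OnLine x l} = Fintype.card F := by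
  have : ({l | OnLine x l} : Finset (F × F × F)) = univ.image (lineThrough x) := by
    ext l
    simp only [mem_filter, mem_univ, true_and, mem_image, onLine_iff_lineThrough]
    constructor
    · intro h; exact ⟨_, h.symm⟩
    · rintro ⟨s, rfl⟩; rfl
  rw [this, card_image_of_injective _ (fun s r h => congrArg Prod.fst h), card_univ]

theorem card_common_lines_le (x y : F × F × F) :
    #{l | OnLine x l ∧ OnLine y l} ≤
      (if x = y then Fintype.card F else 0) + (if Coll x y then 1 else 0) := by
  by_cases h : x = y
  · subst h
    simp [card_lines_through]
  · rw [if_neg h, zero_add]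
    split_ifs with hc
    · refine card_le_one.2 fun l hl m hm => ?_
      simp only [mem_filter, mem_univ, true_and] at hl hm
      have h1 := (hl.1.collAlong hl.2 h).unique (hm.1.collAlong hm.2 h)
      rw [onLine_iff_lineThrough.1 hl.1, onLine_iff_lineThrough.1 hm.1, h1]
    · rw [Nat.le_zero, card_eq_zero, filter_eq_empty_iff]
      rintro l - ⟨h1, h2⟩
      exact hc ⟨_, h1.collAlong h2 h⟩

end Geometry

/-! ### Second-moment bounds for incidences -/

section SecondMoment

open Finset
open scoped Classical

theorem sum_card_filter_sq {α β : Type*} (R : α → β → Prop) (B : Finset α) (S : Finset β) :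
    ∑ z ∈ S, #{x ∈ B | R x z} ^ 2 = ∑ x ∈ B, ∑ y ∈ B, #{z ∈ S | R x z ∧ R y z} := by
  have h1 : ∀ z, #{x ∈ B | R x z} ^ 2 = ∑ x ∈ B, ∑ y ∈ B, if R x z ∧ R y z then 1 else 0 := by
    intro z
    rw [sq, card_filter, sum_mul_sum]
    refine sum_congr rfl fun x _ => sum_congr rfl fun y _ => ?_
    by_cases h : R x z <;> by_cases h' : R y z <;> simp [h, h']
  simp_rw [h1, card_filter]
  rw [sum_comm]
  refine sum_congr rfl fun x _ => ?_
  rw [sum_comm]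

theorem sum_card_filter_comm {α β : Type*} (R : α → β → Prop) (B : Finset α) (S : Finset β) :
    ∑ z ∈ S, #{x ∈ B | R x z} = ∑ x ∈ B, #{z ∈ S | R x z} := by
  simp_rw [card_filter]
  exact sum_comm

variable {F : Type*} [Field F] [Fintype F]

theorem card_cast_sub_one : ((Fintype.card F - 1 : ℕ) : ℝ) = (Fintype.card F : ℝ) - 1 := by
  rw [Nat.cast_sub Fintype.card_pos, Nat.cast_one]

/-- The number of collinear ordered pairs of distinct points inside a set. -/
theorem sum_card_coll_le (B : Finset (F × F × F)) :
    ((∑ z ∈ B, #{x ∈ B | Coll x z} : ℕ) : ℝ) ≤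
      (#B : ℝ) ^ 2 / Fintype.card F + #B * √((Fintype.card F : ℝ) ^ 2 + 2 * #B) := by
  set q : ℝ := (Fintype.card F : ℝ) with hq
  have hq1 : 1 ≤ q := by
    rw [hq]; exact_mod_cast Fintype.card_pos (α := F)
  set b : ℝ := (#B : ℝ) with hb
  have hb0 : 0 ≤ b := by positivity
  set d : F × F × F → ℝ := fun z => (#{x ∈ B | Coll x z} : ℝ) with hd
  have hs1 : ∑ z, d z = b * (q * (q - 1)) := by
    have := sum_card_filter_comm (Coll (F := F)) B univ
    simp only [card_coll, sum_const, smul_eq_mul] at this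
    have h2 : ((∑ z, #{x ∈ B | Coll x z} : ℕ) : ℝ)
      = ((#B * (Fintype.card F * (Fintype.card F - 1)) : ℕ) : ℝ) := by rw [this]
    rw [Nat.cast_mul, Nat.cast_mul, card_cast_sub_one, Nat.cast_sum] at h2
    exact h2
  have hs2 : ∑ z, d z ^ 2 ≤ b * q ^ 2 + q * b ^ 2 := by
    have := sum_card_filter_sq (Coll (F := F)) B univ
    have h3 : ∀ x ∈ B, ∑ y ∈ B, #{z | Coll x z ∧ Coll y z} ≤
        Fintype.card F * (Fintype.card F - 1) + #B * Fintype.card F := by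
      intro x hx
      have h4 : ∀ y ∈ B, #{z | Coll x z ∧ Coll y z} ≤
          (if x = y then Fintype.card F * (Fintype.card F - 1) else 0) + Fintype.card F := by
        intro y _
        split_ifs with h
        · subst h
          simp [card_coll]
        · simp_rw [coll_comm (x := y)]
          simpa using card_coll_coll_le h
      refine (sum_le_sum h4).trans ?_
      rw [sum_add_distrib, sum_ite_eq, if_pos hx, sum_const, smul_eq_mul]
    have h5 := sum_le_sum h3
    rw [← this, sum_const, smul_eq_mul] at h5
    have h6 : ((∑ z, #{x ∈ B | Coll x z} ^ 2 : ℕ) : ℝ) ≤ _ := Nat.cast_le.2 h5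
    rw [Nat.cast_sum] at h6
    push_cast [card_cast_sub_one] at h6
    refine le_trans h6 ?_
    rw [← hq, ← hb]
    nlinarith [mul_nonneg hb0 (zero_le_one.trans hq1)]
  -- The average of `d` over all `q ^ 3` points.
  set μ : ℝ := b * (q - 1) / q ^ 2 with hμ
  have hcard : (Fintype.card (F × F × F) : ℝ) = q ^ 3 := by
    simp only [Fintype.card_prod, Nat.cast_mul]; ring
  have hvar : ∑ z, (d z - μ) ^ 2 ≤ b * (q ^ 2 + 2 * b) := by
    have e : ∑ z, (d z - μ) ^ 2 = ∑ z, d z ^ 2 - 2 * μ * ∑ z, d z + q ^ 3 * μ ^ 2 := by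
      simp_rw [sub_sq]
      rw [sum_add_distrib, sum_sub_distrib, sum_const, card_univ, nsmul_eq_mul, hcard, mul_sum]
      congr 2
      exact sum_congr rfl fun z _ => by ring
    have e2 : - (2 * μ * (b * (q * (q - 1)))) + q ^ 3 * μ ^ 2 = - (q - 1) ^ 2 * b ^ 2 / q := by
      rw [hμ]; field_simp; ring
    have e3 : - (q - 1) ^ 2 * b ^ 2 / q ≤ - (q - 2) * b ^ 2 := by
      rw [div_le_iff₀ (by linarith)]
      nlinarith [sq_nonneg b]
    rw [e, hs1]
    nlinarith [sq_nonneg b]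
  -- Cauchy-Schwarz on `B`, then the variance over all points: an expander mixing bound without
  -- eigenvalues.
  have hcs : (∑ z ∈ B, (d z - μ)) ^ 2 ≤ b * (b * (q ^ 2 + 2 * b)) := by
    have h1 := sq_sum_le_card_mul_sum_sq (s := B) (f := fun z => d z - μ)
    refine h1.trans (mul_le_mul_of_nonneg_left ?_ hb0)
    exact (sum_le_univ_sum_of_nonneg (fun z => sq_nonneg _)).trans hvar
  have h7 : ∑ z ∈ B, (d z - μ) ≤ b * √(q ^ 2 + 2 * b) := by
    have : b * (b * (q ^ 2 + 2 * b)) = (b * √(q ^ 2 + 2 * b)) ^ 2 := by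
      rw [mul_pow, Real.sq_sqrt (by positivity)]; ring
    rw [this] at hcs
    exact (abs_le_of_sq_le_sq' hcs (by positivity)).2
  rw [sum_sub_distrib, sum_const, nsmul_eq_mul] at h7
  have h8 : b * μ ≤ b ^ 2 / q := by
    rw [hμ, mul_div_assoc', div_le_div_iff₀ (by positivity) (by positivity)]
    nlinarith [mul_nonneg (sq_nonneg b) (zero_le_one.trans hq1)]
  rw [Nat.cast_sum]
  change ∑ z ∈ B, d z ≤ _
  linarith

theorem sum_sq_points_on_line_le (B : Finset (F × F × F)) :
    ((∑ l, #{x ∈ B | OnLine x l} ^ 2 : ℕ) : ℝ) ≤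
      #B * Fintype.card F + (#B : ℝ) ^ 2 / Fintype.card F
        + #B * √((Fintype.card F : ℝ) ^ 2 + 2 * #B) := by
  have h := sum_card_filter_sq (OnLine (F := F)) B univ
  have h2 : ∑ x ∈ B, ∑ y ∈ B, #{l | OnLine x l ∧ OnLine y l} ≤
      #B * Fintype.card F + ∑ z ∈ B, #{x ∈ B | Coll x z} := by
    calc _ ≤ ∑ x ∈ B, ∑ y ∈ B,
          ((if x = y then Fintype.card F else 0) + (if Coll x y then 1 else 0)) :=
          sum_le_sum fun x _ => sum_le_sum fun y _ => card_common_lines_le x y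
      _ = _ := by
          simp_rw [sum_add_distrib, sum_ite_eq, card_filter]
          congr 1
          · rw [sum_congr rfl (g := fun _ => Fintype.card F) (fun x hx => by rw [if_pos hx]),
              sum_const, smul_eq_mul]
          · exact sum_comm
  rw [h]
  have h3 := sum_card_coll_le B
  have h4 : ((∑ x ∈ B, ∑ y ∈ B, #{l | OnLine x l ∧ OnLine y l} : ℕ) : ℝ) ≤
    ((#B * Fintype.card F + ∑ z ∈ B, #{x ∈ B | Coll x z} : ℕ) : ℝ) := Nat.cast_le.2 h2
  rw [Nat.cast_add, Nat.cast_mul] at h4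
  linarith

theorem sum_points_on_line (B : Finset (F × F × F)) :
    ∑ l, #{x ∈ B | OnLine x l} = #B * Fintype.card F := by
  rw [sum_card_filter_comm]
  simp [card_lines_through]

/-- Few lines carry much less than the average number of points of a set of size
`40000 q ^ 2`. -/
theorem card_poor_lines_le (B : Finset (F × F × F)) (hB : #B = 40000 * Fintype.card F ^ 2) :
    (#{l : F × F × F | #{x ∈ B | OnLine x l} < 20000} : ℝ) ≤ (Fintype.card F : ℝ) ^ 3 / 24 := by
  set q : ℝ := (Fintype.card F : ℝ) with hq
  have hq1 : 1 ≤ q := by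
    rw [hq]; exact_mod_cast Fintype.card_pos (α := F)
  have hb : (#B : ℝ) = 40000 * q ^ 2 := by rw [hB]; push_cast; rfl
  set f : F × F × F → ℝ := fun l => (#{x ∈ B | OnLine x l} : ℝ) with hf
  have hcard : (Fintype.card (F × F × F) : ℝ) = q ^ 3 := by
    simp only [Fintype.card_prod, Nat.cast_mul]; ring
  have h1 : ∑ l, f l = 40000 * q ^ 3 := by
    have := congrArg (Nat.cast : ℕ → ℝ) (sum_points_on_line B)
    rw [Nat.cast_sum, Nat.cast_mul, hb] at this
    rw [hf, this]; ring
  have hsq : √(q ^ 2 + 2 * (40000 * q ^ 2)) ≤ 283 * q := by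
    rw [show q ^ 2 + 2 * (40000 * q ^ 2) = 80001 * q ^ 2 by ring]
    refine Real.sqrt_le_iff.2 ⟨by positivity, by nlinarith⟩
  have h2 : ∑ l, f l ^ 2 ≤ 40000 * q ^ 3 * 40284 := by
    have := sum_sq_points_on_line_le B
    rw [Nat.cast_sum, hb, ← hq] at this
    push_cast at this
    refine this.trans ?_
    have e : (40000 * q ^ 2) ^ 2 / q = 40000 * 40000 * q ^ 3 := by field_simp
    rw [e]
    have := mul_le_mul_of_nonneg_left hsq (by positivity : 0 ≤ 40000 * q ^ 2)
    nlinarith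
  have h3 : ∑ l, (f l - 40000) ^ 2 ≤ 40000 * 284 * q ^ 3 := by
    have e : ∑ l, (f l - 40000) ^ 2 = ∑ l, f l ^ 2 - 80000 * ∑ l, f l + q ^ 3 * 40000 ^ 2 := by
      simp_rw [sub_sq]
      rw [sum_add_distrib, sum_sub_distrib, sum_const, card_univ, nsmul_eq_mul, hcard, mul_sum]
      congr 2
      exact sum_congr rfl fun z _ => by ring
    rw [e, h1]
    linarith
  -- Chebyshev: the mean is `40000`, so a poor line deviates by more than `20000`.
  have h4 : (#{l : F × F × F | #{x ∈ B | OnLine x l} < 20000} : ℝ) * 20000 ^ 2 ≤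
      ∑ l, (f l - 40000) ^ 2 := by
    rw [← nsmul_eq_mul, ← sum_const]
    refine (sum_le_sum fun l hl => ?_).trans
      (sum_le_univ_sum_of_nonneg (fun z => sq_nonneg (f z - 40000)))
    have h5 : f l < 20000 := by
      have := (mem_filter.1 hl).2
      simp only [hf]; exact_mod_cast this
    nlinarith
  have : 0 ≤ q ^ 3 := by positivity
  linarith

/-- A small set of lines carries at most half of the incidences with any large set of points. -/
theorem sum_points_on_few_lines_le (D : Finset (F × F × F))
    (hD : (#D : ℝ) ≤ (Fintype.card F : ℝ) ^ 3 / 12) (U : Finset (F × F × F))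
    (hU : 40000 * Fintype.card F ^ 2 ≤ #U) :
    ((∑ l ∈ D, #{x ∈ U | OnLine x l} : ℕ) : ℝ) ≤ (Fintype.card F : ℝ) * #U / 2 := by
  set q : ℝ := (Fintype.card F : ℝ) with hq
  have hq1 : 1 ≤ q := by
    rw [hq]; exact_mod_cast Fintype.card_pos (α := F)
  induction h : #U using Nat.strong_induction_on generalizing U with
  | _ n ih =>
  -- Both sides are additive in `U`, so a large `U` is cut into pieces with between `n₀` and `2 n₀`
  -- points, `n₀ = 40000 q ^ 2`; on a piece Cauchy-Schwarz over `D` suffices.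
  by_cases hU2 : #U ≤ 2 * (40000 * Fintype.card F ^ 2)
  · set u : ℝ := (#U : ℝ) with hu
    have hu1 : 40000 * q ^ 2 ≤ u := by rw [hq, hu]; exact_mod_cast hU
    have hu2 : u ≤ 80000 * q ^ 2 := by
      have : (#U : ℝ) ≤ ((2 * (40000 * Fintype.card F ^ 2) : ℕ) : ℝ) := Nat.cast_le.2 hU2
      push_cast at this
      linarith
    have hu0 : 0 ≤ u := by positivity
    have hsq : √(q ^ 2 + 2 * u) ≤ 401 * q := by
      refine Real.sqrt_le_iff.2 ⟨by positivity, by nlinarith⟩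
    have hs := sum_sq_points_on_line_le U
    rw [← hq, ← hu] at hs
    have hs2 : ((∑ l, #{x ∈ U | OnLine x l} ^ 2 : ℕ) : ℝ) ≤ u * q * 80402 := by
      refine hs.trans ?_
      have e : u ^ 2 / q ≤ u * (80000 * q) := by
        rw [div_le_iff₀ (by linarith)]
        nlinarith
      have := mul_le_mul_of_nonneg_left hsq hu0
      nlinarith
    have hcs : ((∑ l ∈ D, #{x ∈ U | OnLine x l} : ℕ) : ℝ) ^ 2 ≤
        #D * ((∑ l, #{x ∈ U | OnLine x l} ^ 2 : ℕ) : ℝ) := by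
      have h1 : (∑ l ∈ D, #{x ∈ U | OnLine x l}) ^ 2 ≤ #D * ∑ l, #{x ∈ U | OnLine x l} ^ 2 :=
        sq_sum_le_card_mul_sum_sq.trans
          (Nat.mul_le_mul_left _ (sum_le_univ_sum_of_nonneg fun z => Nat.zero_le _))
      exact_mod_cast h1
    have hfin : ((∑ l ∈ D, #{x ∈ U | OnLine x l} : ℕ) : ℝ) ^ 2 ≤ (q * u / 2) ^ 2 := by
      refine hcs.trans ?_
      calc _ ≤ q ^ 3 / 12 * (u * q * 80402) := 
          mul_le_mul hD hs2 (Nat.cast_nonneg _) (by positivity)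
        _ ≤ (q * u / 2) ^ 2 := by
          have h0 : 0 ≤ q ^ 2 * u := by positivity
          have := mul_nonneg h0 (sub_nonneg.2 hu1)
          nlinarith
    have := (abs_le_of_sq_le_sq' hfin (by positivity)).2
    rwa [hu, h] at this
  · push Not at hU2
    obtain ⟨W, hWU, hW⟩ := exists_subset_card_eq hU
    have hq0 : 0 < 40000 * Fintype.card F ^ 2 := by
      have := Fintype.card_pos (α := F); positivity
    have hc : #(U \ W) = #U - #W := card_sdiff_of_subset hWU
    have h1 := ih (#W) (by omega) W (by omega) rfl
    have h2 := ih (#(U \ W)) (by omega) (U \ W) (by omega) rfl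
    have h3 : ∑ l ∈ D, #{x ∈ U | OnLine x l} =
        ∑ l ∈ D, #{x ∈ W | OnLine x l} + ∑ l ∈ D, #{x ∈ U \ W | OnLine x l} := by
      rw [← sum_add_distrib]
      refine sum_congr rfl fun l _ => ?_
      rw [← card_union_of_disjoint
        (disjoint_filter_filter disjoint_sdiff), ← filter_union, union_sdiff_of_subset hWU]
    rw [h3, Nat.cast_add, ← h]
    have h4 : (#U : ℝ) = #W + #(U \ W) := by
      rw [hc]; push_cast [card_le_card hWU]; ring
    rw [h4]
    linarith

end SecondMoment

/-! ### Union bound over random bipartitions of the lines -/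

section RandomColouring

open Finset
open scoped Classical

variable {α : Type*} [Fintype α]

/-- Fix `x₀ ∈ A` and flip a colouring constant on `A` along a subset of `A.erase x₀`. The unflipped
value at `x₀` reveals the subset, so this is injective. -/
theorem card_constant_on_mul_le {A : Finset α} {k : ℕ} (hA : k + 1 ≤ #A) :
    #{f : α → Bool | ∀ x ∈ A, ∀ y ∈ A, f x = f y} * 2 ^ k ≤ 2 ^ Fintype.card α := by
  obtain ⟨x₀, hx₀⟩ : A.Nonempty := card_pos.1 (by omega)
  have hA' : k ≤ #(A.erase x₀) := by rw [card_erase_of_mem hx₀]; omega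
  calc _ ≤ #{f : α → Bool | ∀ x ∈ A, ∀ y ∈ A, f x = f y} * #(A.erase x₀).powerset := by
        rw [card_powerset]
        exact Nat.mul_le_mul_left _ (Nat.pow_le_pow_right two_pos hA')
    _ = #(({f : α → Bool | ∀ x ∈ A, ∀ y ∈ A, f x = f y} : Finset _) ×ˢ
          (A.erase x₀).powerset) := (card_product _ _).symm
    _ ≤ #(univ : Finset (α → Bool)) := by
        refine card_le_card_of_injOn (fun p x => if x ∈ p.2 then !(p.1 x) else p.1 x)
          (fun _ _ => mem_univ _) ?_
        rintro ⟨f, S⟩ h ⟨g, T⟩ h' e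
        simp only [coe_product, Set.mem_prod, mem_coe, mem_filter, mem_univ, true_and,
          mem_powerset] at h h'
        have hx : ∀ x, (if x ∈ S then !(f x) else f x) = if x ∈ T then !(g x) else g x :=
          fun x => congrFun e x
        have hS : x₀ ∉ S := fun hh => (mem_erase.1 (h.2 hh)).1 rfl
        have hT : x₀ ∉ T := fun hh => (mem_erase.1 (h'.2 hh)).1 rfl
        have h0 : f x₀ = g x₀ := by simpa [hS, hT] using hx x₀
        have hST : S = T := by
          ext x
          by_cases hxA : x ∈ A
          · have h1 := hx x
            rw [h.1 x hxA x₀ hx₀, h'.1 x hxA x₀ hx₀, h0] at h1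
            by_cases h2 : x ∈ S <;> by_cases h3 : x ∈ T <;> simp [h2, h3] at h1 ⊢
          · exact ⟨fun hh => absurd (mem_erase.1 (h.2 hh)).2 hxA,
              fun hh => absurd (mem_erase.1 (h'.2 hh)).2 hxA⟩
        subst hST
        refine Prod.ext (funext fun x => ?_) rfl
        have h1 := hx x
        by_cases h2 : x ∈ S <;> simpa [h2] using h1
    _ = 2 ^ Fintype.card α := by rw [card_univ, Fintype.card_fun, Fintype.card_bool]

variable {β : Type*} [Fintype β]

theorem card_all_constant_mul_le {D : Finset β} {A : β → Finset α} {k : ℕ}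
    (hA : ∀ l ∈ D, k + 1 ≤ #(A l)) :
    #{c : β → α → Bool | ∀ l ∈ D, ∀ x ∈ A l, ∀ y ∈ A l, c l x = c l y} * 2 ^ (k * #D) ≤
      2 ^ (Fintype.card α * Fintype.card β) := by
  have h1 : ({c : β → α → Bool | ∀ l ∈ D, ∀ x ∈ A l, ∀ y ∈ A l, c l x = c l y} : Finset _) =
      Fintype.piFinset (fun l => if l ∈ D then
        ({f : α → Bool | ∀ x ∈ A l, ∀ y ∈ A l, f x = f y} : Finset _) else univ) := by
    ext c
    simp only [mem_filter, mem_univ, true_and, Fintype.mem_piFinset]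
    refine forall_congr' fun l => ?_
    by_cases h : l ∈ D <;> simp [h]
  have h2 : 2 ^ (k * #D) = ∏ l : β, if l ∈ D then 2 ^ k else 1 := by
    rw [prod_ite, prod_const, prod_const_one, mul_one, pow_mul, filter_mem_eq_inter, univ_inter]
  rw [h1, Fintype.card_piFinset, h2, ← prod_mul_distrib, pow_mul, ← card_univ (α := β),
    ← prod_const]
  refine prod_le_prod' fun l _ => ?_
  by_cases h : l ∈ D
  · simp only [h, if_true]
    exact card_constant_on_mul_le (hA l h)
  · simp only [h, if_false, mul_one]
    rw [card_univ, Fintype.card_fun, Fintype.card_bool]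

theorem exists_colouring_not_all_constant {ι : Type*} (T : Finset ι) (D : ι → Finset β)
    (A : ι → β → Finset α) {k M : ℕ} (hA : ∀ i ∈ T, ∀ l ∈ D i, k + 1 ≤ #(A i l))
    (hM : ∀ i ∈ T, M ≤ k * #(D i)) (hT : #T < 2 ^ M) :
    ∃ c : β → α → Bool, ∀ i ∈ T, ¬ ∀ l ∈ D i, ∀ x ∈ A i l, ∀ y ∈ A i l, c l x = c l y := by
  by_contra! hcon
  set E : ι → Finset (β → α → Bool) := fun i =>
    {c | ∀ l ∈ D i, ∀ x ∈ A i l, ∀ y ∈ A i l, c l x = c l y}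
  have hcov : (univ : Finset (β → α → Bool)) ⊆ T.biUnion E := fun c _ => by
    obtain ⟨i, hi, h⟩ := hcon c
    exact mem_biUnion.2 ⟨i, hi, mem_filter.2 ⟨mem_univ _, h⟩⟩
  have htot : #(univ : Finset (β → α → Bool)) = 2 ^ (Fintype.card α * Fintype.card β) := by
    rw [card_univ, Fintype.card_fun, Fintype.card_fun, Fintype.card_bool, pow_mul]
  have h1 : 2 ^ (Fintype.card α * Fintype.card β) ≤ ∑ i ∈ T, #(E i) := by
    rw [← htot]
    exact (card_le_card hcov).trans card_biUnion_le
  have h2 : ∀ i ∈ T, #(E i) * 2 ^ M ≤ 2 ^ (Fintype.card α * Fintype.card β) := fun i hi =>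
    (Nat.mul_le_mul_left _ (Nat.pow_le_pow_right two_pos (hM i hi))).trans
      (card_all_constant_mul_le (hA i hi))
  have h3 : 2 ^ (Fintype.card α * Fintype.card β) * 2 ^ M ≤
      #T * 2 ^ (Fintype.card α * Fintype.card β) := by
    calc _ ≤ (∑ i ∈ T, #(E i)) * 2 ^ M := Nat.mul_le_mul_right _ h1
      _ = ∑ i ∈ T, #(E i) * 2 ^ M := sum_mul _ _ _
      _ ≤ ∑ i ∈ T, 2 ^ (Fintype.card α * Fintype.card β) := sum_le_sum h2
      _ = _ := by rw [sum_const, smul_eq_mul]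
  rw [mul_comm] at h3
  exact absurd (Nat.le_of_mul_le_mul_right h3 (by positivity)) (not_le.2 hT)

variable {F : Type*} [Field F] [Fintype F]

/-- Some choice of a bipartition of every line makes few rich lines monochromatic on `B`, for all
`B` of size `40000 q ^ 2`. -/
theorem exists_bipartition
    (hq : (Fintype.card F ^ 3) ^ (40000 * Fintype.card F ^ 2) ≤ 2 ^ Fintype.card F ^ 3) :
    ∃ c : F × F × F → F × F × F → Bool, ∀ B : Finset (F × F × F),
      #B = 40000 * Fintype.card F ^ 2 →
      24 * #{l | 20000 ≤ #{x ∈ B | OnLine x l} ∧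
        ∀ x ∈ B, ∀ y ∈ B, OnLine x l → OnLine y l → c l x = c l y} ≤ Fintype.card F ^ 3 := by
  have hcard : Fintype.card (F × F × F) = Fintype.card F ^ 3 := by
    simp only [Fintype.card_prod]; ring
  have hpos : 0 < Fintype.card F ^ 3 := pow_pos Fintype.card_pos 3
  set N := Fintype.card F ^ 3 with hN
  set T : Finset (Finset (F × F × F) × Finset (F × F × F)) :=
    {p ∈ (powersetCard (40000 * Fintype.card F ^ 2) univ) ×ˢ univ |
      N ≤ 24 * #p.2 ∧ ∀ l ∈ p.2, 20000 ≤ #{x ∈ p.1 | OnLine x l}} with hTdef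
  have hTc : #T < 2 ^ (2 * N + 1) := by
    calc #T ≤ N.choose (40000 * Fintype.card F ^ 2) * 2 ^ N := by
          refine (card_filter_le _ _).trans ?_
          rw [card_product, card_powersetCard, card_univ, card_univ, Fintype.card_finset, hcard]
      _ ≤ 2 ^ N * 2 ^ N := by
          refine Nat.mul_le_mul_right _ (le_trans ?_ hq)
          exact Nat.choose_le_pow _ _
      _ = 2 ^ (2 * N) := by rw [← pow_add, two_mul]
      _ < _ := Nat.pow_lt_pow_right one_lt_two (by omega)
  -- At most `2 ^ (2 * N)` pairs compete with a probability `2 ^ (-19999 * #D)` each, and `#D ≥ N /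
  -- 24`.
  obtain ⟨c, hc⟩ := exists_colouring_not_all_constant T (fun p => p.2)
    (fun p l => {x ∈ p.1 | OnLine x l}) (k := 19999) (M := 2 * N + 1)
    (fun p hp l hl => (mem_filter.1 hp).2.2 l hl)
    (fun p hp => by have := (mem_filter.1 hp).2.1; omega) hTc
  refine ⟨c, fun B hB => ?_⟩
  by_contra hcon
  push Not at hcon
  refine hc (B, ({l | 20000 ≤ #{x ∈ B | OnLine x l} ∧ ∀ x ∈ B, ∀ y ∈ B, OnLine x l →
    OnLine y l → c l x = c l y} : Finset (F × F × F))) ?_ ?_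
  · refine mem_filter.2 ⟨mem_product.2 ⟨mem_powersetCard.2 ⟨subset_univ _, hB⟩, mem_univ _⟩,
      hcon.le, fun l hl => ?_⟩
    exact (mem_filter.1 hl).2.1
  · intro l hl x hx y hy
    have hx := mem_filter.1 hx
    have hy := mem_filter.1 hy
    exact (mem_filter.1 hl).2.2 x hx.1 y hy.1 hx.2 hy.2

end RandomColouring

/-! ### The triangle-free graph and its degrees -/

section BipartitionGraph

open Finset
open scoped Classical

variable {F : Type*} [Field F]

/-- The graph on the points of `F ^ 3` in which every line carries a complete bipartite graph, with
the parts given by `c`. -/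
def bipartitionGraph (c : F × F × F → F × F × F → Bool) : SimpleGraph (F × F × F) where
  Adj x y := ∃ l, OnLine x l ∧ OnLine y l ∧ c l x ≠ c l y
  symm := ⟨fun _ _ ⟨l, h1, h2, h3⟩ => ⟨l, h2, h1, h3.symm⟩⟩
  loopless := ⟨fun _ ⟨_, _, _, h⟩ => h rfl⟩

/-- Three pairwise adjacent points would lie on a single line, whose graph is bipartite. -/
theorem bipartitionGraph_cliqueFree (c : F × F × F → F × F × F → Bool) :
    (bipartitionGraph c).CliqueFree 3 := by
  intro s hs
  obtain ⟨x, y, z, hxy, hxz, hyz, -⟩ := SimpleGraph.is3Clique_iff.1 hs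
  have nxy := hxy.ne
  have nxz := hxz.ne
  have nyz := hyz.ne
  obtain ⟨l, hl1, hl2, hl⟩ := hxy
  obtain ⟨m, hm1, hm2, hm⟩ := hxz
  obtain ⟨k, hk1, hk2, hk⟩ := hyz
  have cl := hl1.collAlong hl2 nxy
  have cm := hm1.collAlong hm2 nxz
  have ck := hk1.collAlong hk2 nyz
  have e1 : l = k := by
    rw [onLine_iff_lineThrough.1 hl2, onLine_iff_lineThrough.1 hk1, cl.triangle ck cm]
  have e2 : m = k := by
    rw [onLine_iff_lineThrough.1 hm2, onLine_iff_lineThrough.1 hk2, cm.triangle ck.symm cl]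
  subst e1
  subst e2
  revert hl hm hk
  cases c m x <;> cases c m y <;> cases c m z <;> simp

variable [Fintype F]

theorem card_lines_bichromatic_le (c : F × F × F → F × F × F → Bool) (y u : F × F × F) :
    #{l | OnLine y l ∧ OnLine u l ∧ c l y ≠ c l u} ≤
      if (bipartitionGraph c).Adj y u then 1 else 0 := by
  split_ifs with h
  · refine card_le_one.2 fun l hl m hm => ?_
    simp only [mem_filter, mem_univ, true_and] at hl hm
    have hne : y ≠ u := h.ne
    rw [onLine_iff_lineThrough.1 hl.1, onLine_iff_lineThrough.1 hm.1,
      (hl.1.collAlong hl.2.1 hne).unique (hm.1.collAlong hm.2.1 hne)]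
  · rw [Nat.le_zero, card_eq_zero, filter_eq_empty_iff]
    exact fun l _ hl => h ⟨l, hl⟩

/-- A line showing both colours on `B` contributes, for each point `u ∈ U` on it, a neighbour of `u`
in `B`. Two points share at most one line, so edges are not overcounted. The remaining lines,
monochromatic or poor, carry at most half of the incidences with `U`. -/
theorem edges_lower_bound (c : F × F × F → F × F × F → Bool)
    (hc : ∀ B : Finset (F × F × F), #B = 40000 * Fintype.card F ^ 2 →
      24 * #{l | 20000 ≤ #{x ∈ B | OnLine x l} ∧
        ∀ x ∈ B, ∀ y ∈ B, OnLine x l → OnLine y l → c l x = c l y} ≤ Fintype.card F ^ 3)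
    {B U : Finset (F × F × F)} (hB : #B = 40000 * Fintype.card F ^ 2)
    (hU : 40000 * Fintype.card F ^ 2 ≤ #U) :
    (Fintype.card F : ℝ) * #U / 2 ≤
      ((∑ y ∈ B, #{u ∈ U | (bipartitionGraph c).Adj y u} : ℕ) : ℝ) := by
  set M : Finset (F × F × F) := {l | 20000 ≤ #{x ∈ B | OnLine x l} ∧
        ∀ x ∈ B, ∀ y ∈ B, OnLine x l → OnLine y l → c l x = c l y} with hM
  set S : Finset (F × F × F) := {l | #{x ∈ B | OnLine x l} < 20000} with hS
  have h1 := hc B hB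
  have h2 := card_poor_lines_le B hB
  have hD : (#(M ∪ S) : ℝ) ≤ (Fintype.card F : ℝ) ^ 3 / 12 := by
    have h3 : ((24 * #M : ℕ) : ℝ) ≤ ((Fintype.card F ^ 3 : ℕ) : ℝ) := Nat.cast_le.2 h1
    have h4 : (#(M ∪ S) : ℝ) ≤ #M + #S := by exact_mod_cast card_union_le _ _
    push_cast at h3
    linarith
  have h5 := sum_points_on_few_lines_le (M ∪ S) hD U hU
  have h6 : ∑ l ∈ (M ∪ S)ᶜ, #{u ∈ U | OnLine u l} ≤
      ∑ y ∈ B, #{u ∈ U | (bipartitionGraph c).Adj y u} := by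
    have e1 : ∑ y ∈ B, #{u ∈ U | (bipartitionGraph c).Adj y u} =
        ∑ u ∈ U, ∑ y ∈ B, if (bipartitionGraph c).Adj y u then 1 else 0 := by
      simp_rw [card_filter]; exact sum_comm
    have e2 : ∑ u ∈ U, ∑ y ∈ B, #{l | OnLine y l ∧ OnLine u l ∧ c l y ≠ c l u} =
        ∑ l, ∑ u ∈ U, #{y ∈ B | OnLine y l ∧ OnLine u l ∧ c l y ≠ c l u} := by
      rw [sum_comm (s := univ)]
      refine sum_congr rfl fun u _ => ?_
      simp_rw [card_filter]
      exact sum_comm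
    rw [e1]
    refine le_trans ?_ (sum_le_sum fun u _ => sum_le_sum fun y _ => card_lines_bichromatic_le c y u)
    rw [e2]
    refine le_trans (sum_le_sum fun l hl => ?_)
      (sum_le_sum_of_subset (subset_univ (M ∪ S)ᶜ))
    rw [card_filter]
    refine sum_le_sum fun u _ => ?_
    split_ifs with hul
    · rw [Nat.one_le_iff_ne_zero, Ne, card_eq_zero, filter_eq_empty_iff]
      intro hcon
      have hcon : ∀ y ∈ B, OnLine y l → c l y = c l u := fun y hy hyl => by
        by_contra hne
        exact hcon hy ⟨hyl, hul, hne⟩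
      rw [mem_compl, mem_union, not_or, hM, hS, mem_filter, mem_filter] at hl
      refine hl.1 ⟨mem_univ _, ?_, fun x hx y hy hxl hyl => ?_⟩
      · by_contra hlt
        exact hl.2 ⟨mem_univ _, not_le.1 hlt⟩
      · rw [hcon x hx hxl, hcon y hy hyl]
    · exact Nat.zero_le _
  have h7 := sum_points_on_line U
  rw [← sum_add_sum_compl (M ∪ S)] at h7
  have h8 : ((∑ l ∈ M ∪ S, #{u ∈ U | OnLine u l} : ℕ) : ℝ) +
    ((∑ l ∈ (M ∪ S)ᶜ, #{u ∈ U | OnLine u l} : ℕ) : ℝ) = #U * Fintype.card F := by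
    exact_mod_cast h7
  have h9 : ((∑ l ∈ (M ∪ S)ᶜ, #{u ∈ U | OnLine u l} : ℕ) : ℝ) ≤
    ((∑ y ∈ B, #{u ∈ U | (bipartitionGraph c).Adj y u} : ℕ) : ℝ) := Nat.cast_le.2 h6
  linarith

/-- In any set of points, only few points have few neighbours in that set. -/
theorem card_low_degree_lt (c : F × F × F → F × F × F → Bool)
    (hc : ∀ B : Finset (F × F × F), #B = 40000 * Fintype.card F ^ 2 →
      24 * #{l | 20000 ≤ #{x ∈ B | OnLine x l} ∧
        ∀ x ∈ B, ∀ y ∈ B, OnLine x l → OnLine y l → c l x = c l y} ≤ Fintype.card F ^ 3)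
    (U : Finset (F × F × F)) :
    #{y ∈ U | (#{u ∈ U | (bipartitionGraph c).Adj y u} : ℝ) <
      1 / (80000 * Fintype.card F) * #U} < 40000 * Fintype.card F ^ 2 := by
  by_contra! hcon
  obtain ⟨B, hBs, hB⟩ := exists_subset_card_eq hcon
  have hq : 0 < Fintype.card F := Fintype.card_pos
  have hU : 40000 * Fintype.card F ^ 2 ≤ #U := hcon.trans (card_filter_le _ _)
  have h1 := edges_lower_bound c hc hB hU
  rw [Nat.cast_sum] at h1
  have hne : B.Nonempty := card_pos.1 (by rw [hB]; positivity)
  have h2 := sum_lt_sum_of_nonempty hne (fun y hy => (mem_filter.1 (hBs hy)).2)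
  rw [sum_const, nsmul_eq_mul, hB] at h2
  have h3 : ((40000 * Fintype.card F ^ 2 : ℕ) : ℝ) * (1 / (80000 * Fintype.card F) * #U) =
      (Fintype.card F : ℝ) * #U / 2 := by
    have : (Fintype.card F : ℝ) ≠ 0 := by positivity
    push_cast
    field_simp
    ring
  linarith

end BipartitionGraph

/-! ### Counting independent tuples and the random map -/

section IndependentTuples

open Finset
open scoped Classical

variable {P : Type*} [Fintype P]

/-- The `t`-tuples (repetitions allowed) of vertices in `U` without adjacent entries. -/
noncomputable def indepTuples (H : SimpleGraph P) (t : ℕ) (U : Finset P) : Finset (Fin t → P) :=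
  {f | (∀ i, f i ∈ U) ∧ ∀ i j, ¬ H.Adj (f i) (f j)}

theorem mem_indepTuples {H : SimpleGraph P} {t : ℕ} {U : Finset P} {f : Fin t → P} :
    f ∈ indepTuples H t U ↔ (∀ i, f i ∈ U) ∧ ∀ i j, ¬ H.Adj (f i) (f j) := by
  simp [indepTuples]

theorem card_indepTuples_succ_le (H : SimpleGraph P) (t : ℕ) (U : Finset P) :
    #(indepTuples H (t + 1) U) ≤ ∑ y ∈ U, #(indepTuples H t {u ∈ U | ¬ H.Adj y u}) := by
  rw [← card_sigma]
  refine card_le_card_of_injOn (fun f => ⟨f 0, Fin.tail f⟩) ?_ ?_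
  · intro f hf
    rw [mem_coe, mem_indepTuples] at hf
    simp only [coe_sigma, Set.mem_sigma_iff, mem_coe, mem_indepTuples, mem_filter, Fin.tail]
    exact ⟨hf.1 0, fun i => ⟨hf.1 _, hf.2 _ _⟩, fun i j => hf.2 _ _⟩
  · intro f _ g _ e
    simp only [Sigma.mk.injEq, heq_eq_eq] at e
    rw [← Fin.cons_self_tail f, ← Fin.cons_self_tail g, e.1, e.2]

/-- Induction with the potential `(#U + 1) ^ θ`. A first entry of low degree has at most `n₀` values
and leaves the potential no larger. Any other first entry multiplies it by at most `exp (-ε θ / 2) ≤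
1 / |P|`, which pays for all its choices. The factor per entry is thus at most `n₀ + 1 ≤ 2 n₀`. -/
theorem card_indepTuples_le (H : SimpleGraph P) {n₀ : ℕ} {ε θ : ℝ} (hε : 0 < ε)
    (hθ0 : 0 ≤ θ) (hθ : (Fintype.card P : ℝ) ≤ Real.exp (ε * θ / 2))
    (hH : ∀ U : Finset P, #{y ∈ U | (#{u ∈ U | H.Adj y u} : ℝ) < ε * #U} < n₀)
    (t : ℕ) (U : Finset P) :
    (#(indepTuples H t U) : ℝ) ≤ (2 * n₀ : ℝ) ^ t * ((#U : ℝ) + 1) ^ θ := by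
  induction t generalizing U with
  | zero =>
    rw [pow_zero, one_mul]
    have h1 : #(indepTuples H 0 U) ≤ 1 := by
      refine (card_le_univ _).trans ?_
      simp
    calc (#(indepTuples H 0 U) : ℝ) ≤ 1 := by exact_mod_cast h1
      _ ≤ _ := Real.one_le_rpow (by linarith [Nat.cast_nonneg (α := ℝ) #U]) hθ0
  | succ t ih =>
    have hn₀ : 1 ≤ n₀ := Nat.one_le_iff_ne_zero.2 fun h => by
      have := hH U; omega
    set Z := {y ∈ U | (#{u ∈ U | H.Adj y u} : ℝ) < ε * #U} with hZ
    set w : ℝ := ((#U : ℝ) + 1) ^ θ with hw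
    have hU1 : (0 : ℝ) < (#U : ℝ) + 1 := by positivity
    have hw0 : 0 ≤ w := by positivity
    set M : ℝ := (2 * n₀ : ℝ) ^ t with hM
    have hM0 : 0 ≤ M := by positivity
    have hbad : ∀ y ∈ Z, (#(indepTuples H t {u ∈ U | ¬ H.Adj y u}) : ℝ) ≤ M * w := by
      intro y _
      refine (ih _).trans (mul_le_mul_of_nonneg_left ?_ hM0)
      refine Real.rpow_le_rpow (by positivity) ?_ hθ0
      have : #{u ∈ U | ¬ H.Adj y u} ≤ #U := card_filter_le _ _
      exact add_le_add_left (Nat.cast_le.2 this) 1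
    have hgood : ∀ y ∈ U \ Z, (#(indepTuples H t {u ∈ U | ¬ H.Adj y u}) : ℝ) ≤
        M * (w * Real.exp (-(ε * θ / 2))) := by
      intro y hy
      rw [Finset.mem_sdiff, hZ, mem_filter, not_and, not_lt] at hy
      refine (ih _).trans (mul_le_mul_of_nonneg_left ?_ hM0)
      have h1 := hy.2 hy.1
      have h2 : (#{u ∈ U | H.Adj y u} : ℝ) + #{u ∈ U | ¬ H.Adj y u} = #U := by
        exact_mod_cast card_filter_add_card_filter_not (s := U) (fun u => H.Adj y u)
      have h3 : (1 : ℝ) ≤ #U := by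
        exact_mod_cast card_pos.2 ⟨y, hy.1⟩
      have h4 : (#{u ∈ U | ¬ H.Adj y u} : ℝ) + 1 ≤ ((#U : ℝ) + 1) * Real.exp (-(ε / 2)) := by
        have h5 : 1 - ε / 2 ≤ Real.exp (-(ε / 2)) := by
          linarith [Real.add_one_le_exp (-(ε / 2))]
        have h6 := mul_le_mul_of_nonneg_left h5 hU1.le
        nlinarith
      calc ((#{u ∈ U | ¬ H.Adj y u} : ℝ) + 1) ^ θ
          ≤ (((#U : ℝ) + 1) * Real.exp (-(ε / 2))) ^ θ :=
            Real.rpow_le_rpow (by positivity) h4 hθ0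
        _ = w * Real.exp (-(ε * θ / 2)) := by
            rw [Real.mul_rpow hU1.le (Real.exp_pos _).le, ← Real.exp_mul]
            congr 2
            ring
    have hU : (#(U \ Z) : ℝ) * Real.exp (-(ε * θ / 2)) ≤ 1 := by
      rw [Real.exp_neg, ← div_eq_mul_inv, div_le_one (Real.exp_pos _)]
      refine le_trans ?_ hθ
      exact_mod_cast card_le_univ _
    have hZc : (#Z : ℝ) ≤ n₀ := by exact_mod_cast (hH U).le
    have hn1 : (1 : ℝ) ≤ n₀ := by exact_mod_cast hn₀
    calc (#(indepTuples H (t + 1) U) : ℝ)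
        ≤ ∑ y ∈ U, (#(indepTuples H t {u ∈ U | ¬ H.Adj y u}) : ℝ) := by
          exact_mod_cast card_indepTuples_succ_le H t U
      _ = ∑ y ∈ U \ Z, (#(indepTuples H t {u ∈ U | ¬ H.Adj y u}) : ℝ) +
          ∑ y ∈ Z, (#(indepTuples H t {u ∈ U | ¬ H.Adj y u}) : ℝ) :=
          (sum_sdiff (filter_subset _ _)).symm
      _ ≤ #(U \ Z) * (M * (w * Real.exp (-(ε * θ / 2)))) + #Z * (M * w) := by
          refine add_le_add ?_ ?_
          · rw [← nsmul_eq_mul, ← sum_const]; exact sum_le_sum hgood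
          · rw [← nsmul_eq_mul, ← sum_const]; exact sum_le_sum hbad
      _ = M * w * (#(U \ Z) * Real.exp (-(ε * θ / 2)) + #Z) := by ring
      _ ≤ M * w * (2 * n₀) := by
          refine mul_le_mul_of_nonneg_left ?_ (mul_nonneg hM0 hw0)
          linarith
      _ = (2 * n₀ : ℝ) ^ (t + 1) * w := by rw [pow_succ]; ring

/-- A random map into a triangle-free graph `H` with few independent tuples shows that a Ramsey
graph has many cliques. -/
theorem le_card_cliqueFinset_of_isRamsey [Nonempty P] {H : SimpleGraph P} (hH : H.CliqueFree 3)
    {V : Type*} [Fintype V] [DecidableEq V] {G : SimpleGraph V} [DecidableRel G.Adj] {t : ℕ}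
    (hG : IsRamsey G 3 t) :
    Fintype.card P ^ t ≤ #(G.cliqueFinset t) * #(indepTuples H t univ) := by
  by_contra! hlt
  -- The maps under which the clique `Q` receives no red edge.
  set E : Finset V → Finset (V → P) := fun Q =>
    {φ | ∀ x ∈ Q, ∀ y ∈ Q, ¬ H.Adj (φ x) (φ y)} with hEdef
  have hE : ∀ Q ∈ G.cliqueFinset t, #(E Q) * Fintype.card P ^ t ≤
      #(indepTuples H t univ) * Fintype.card P ^ Fintype.card V := by
    intro Q hQ
    have hQc : #Q = t := (SimpleGraph.mem_cliqueFinset_iff.1 hQ).card_eq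
    let e : Fin t ≃ Q := (Q.equivFinOfCardEq hQc).symm
    have h1 : #(E Q) ≤ #(indepTuples H t univ ×ˢ (univ : Finset ((Qᶜ : Finset V) → P))) := by
      refine card_le_card_of_injOn (fun φ => (fun i => φ (e i), fun x => φ x)) ?_ ?_
      · intro φ hφ
        rw [mem_coe, hEdef, mem_filter] at hφ
        simp only [coe_product, Set.mem_prod, mem_coe, mem_indepTuples, mem_univ, implies_true,
          true_and, and_true]
        exact fun i j => hφ.2 _ (e i).2 _ (e j).2
      · intro φ _ ψ _ h
        simp only [Prod.mk.injEq] at h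
        funext x
        by_cases hx : x ∈ Q
        · simpa using congrFun h.1 (e.symm ⟨x, hx⟩)
        · exact congrFun h.2 ⟨x, mem_compl.2 hx⟩
    rw [card_product, card_univ (α := (Qᶜ : Finset V) → P), Fintype.card_fun, Fintype.card_coe,
      card_compl, hQc] at h1
    calc _ ≤ _ := Nat.mul_le_mul_right _ h1
      _ = _ := by
        rw [mul_assoc, ← pow_add, Nat.sub_add_cancel (hQc ▸ card_le_univ Q)]
  obtain ⟨φ, hφ⟩ : ∃ φ : V → P, ∀ Q ∈ G.cliqueFinset t, φ ∉ E Q := by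
    by_contra! hcon
    have hcov : (univ : Finset (V → P)) ⊆ (G.cliqueFinset t).biUnion E := fun φ _ => by
      obtain ⟨Q, hQ, h⟩ := hcon φ
      exact mem_biUnion.2 ⟨Q, hQ, h⟩
    have h1 := (card_le_card hcov).trans card_biUnion_le
    rw [card_univ, Fintype.card_fun] at h1
    have h2 : Fintype.card P ^ Fintype.card V * Fintype.card P ^ t ≤
        (#(G.cliqueFinset t) * #(indepTuples H t univ)) * Fintype.card P ^ Fintype.card V := by
      calc _ ≤ (∑ Q ∈ G.cliqueFinset t, #(E Q)) * Fintype.card P ^ t := Nat.mul_le_mul_right _ h1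
        _ = ∑ Q ∈ G.cliqueFinset t, #(E Q) * Fintype.card P ^ t := sum_mul _ _ _
        _ ≤ ∑ Q ∈ G.cliqueFinset t, #(indepTuples H t univ) * Fintype.card P ^ Fintype.card V :=
          sum_le_sum hE
        _ = _ := by rw [sum_const, smul_eq_mul, mul_assoc]
    rw [mul_comm] at h2
    have hm : 0 < Fintype.card P := Fintype.card_pos
    exact absurd (Nat.le_of_mul_le_mul_right h2 (by positivity)) (not_le.2 hlt)
  rcases hG (G ⊓ H.comap φ) inf_le_left with h | h
  · refine h fun s hs => ?_
    obtain ⟨a, b, c, hab, hac, hbc, -⟩ := SimpleGraph.is3Clique_iff.1 hs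
    exact hH _ (SimpleGraph.is3Clique_triple_iff.2 ⟨hab.2, hac.2, hbc.2⟩)
  · refine h fun Q hQ => ?_
    have hQG : Q ∈ G.cliqueFinset t :=
      SimpleGraph.mem_cliqueFinset_iff.2 (hQ.mono sdiff_le)
    have h1 := hφ Q hQG
    simp only [hEdef, mem_filter, mem_univ, true_and] at h1
    push Not at h1
    obtain ⟨x, hx, y, hy, hxy⟩ := h1
    have hne : x ≠ y := fun e => hxy.ne (congrArg φ e)
    have h2 := hQ.isClique hx hy hne
    rw [SimpleGraph.sdiff_adj] at h2
    exact h2.2 ⟨h2.1, hxy⟩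

end IndependentTuples

/-! ### Clique counts, Kruskal-Katona and basic Ramsey bounds -/

section Cliques

open Finset
open scoped Classical

variable {V : Type*}

theorem copyCount_top_eq_classical [Fintype V] (G : SimpleGraph V) (s : ℕ) :
    G.copyCount (⊤ : SimpleGraph (Fin s)) = #(G.cliqueFinset s) := by
  have hadj : ∀ G' : G.Subgraph, Nonempty ((⊤ : SimpleGraph (Fin s)) ≃g G'.coe) →
      ∀ x ∈ G'.verts, ∀ y ∈ G'.verts, (G'.Adj x y ↔ x ≠ y) := by
    rintro G' ⟨e⟩ x hx y hy
    have h := e.symm.map_adj_iff (v := ⟨x, hx⟩) (w := ⟨y, hy⟩)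
    rw [SimpleGraph.top_adj, e.symm.injective.ne_iff] at h
    rw [← SimpleGraph.Subgraph.coe_adj G' ⟨x, hx⟩ ⟨y, hy⟩, ← h]
    simp
  rw [SimpleGraph.copyCount]
  refine card_bij (fun G' _ => ({x | x ∈ G'.verts} : Finset V)) ?_ ?_ ?_
  · intro G' h
    have h := (mem_filter.1 h).2
    have ha := hadj G' h
    obtain ⟨e⟩ := h
    rw [SimpleGraph.mem_cliqueFinset_iff]
    refine ⟨fun x hx y hy hne => ?_, ?_⟩
    · exact ((ha x (mem_filter.1 hx).2 y (mem_filter.1 hy).2).2 hne).adj_sub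
    · rw [← Fintype.card_subtype]
      exact (Fintype.card_congr e.toEquiv).symm.trans (Fintype.card_fin s)
  · intro G₁ h₁ G₂ h₂ he
    have h₁ := hadj G₁ (mem_filter.1 h₁).2
    have h₂ := hadj G₂ (mem_filter.1 h₂).2
    have hv : G₁.verts = G₂.verts := by
      ext x
      simpa using Finset.ext_iff.1 he x
    refine SimpleGraph.Subgraph.ext hv ?_
    funext x y
    refine propext ⟨fun h => ?_, fun h => ?_⟩
    · have hx := G₁.edge_vert h
      have hy := G₁.edge_vert h.symm
      exact (h₂ x (hv ▸ hx) y (hv ▸ hy)).2 h.adj_sub.ne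
    · have hx := G₂.edge_vert h
      have hy := G₂.edge_vert h.symm
      exact (h₁ x (hv ▸ hx) y (hv ▸ hy)).2 h.adj_sub.ne
  · intro Q hQ
    rw [SimpleGraph.mem_cliqueFinset_iff] at hQ
    refine ⟨(⊤ : G.Subgraph).induce (Q : Set V), ?_, ?_⟩
    swap
    · ext x
      simp
    rw [mem_filter]
    refine ⟨mem_univ _, ?_⟩
    let e : Fin s ≃ ((⊤ : G.Subgraph).induce (Q : Set V)).verts :=
      (Q.equivFinOfCardEq hQ.card_eq).symm
    refine ⟨⟨e, fun {a b} => ?_⟩⟩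
    rw [SimpleGraph.Subgraph.coe_adj, SimpleGraph.Subgraph.induce_adj, SimpleGraph.top_adj,
      SimpleGraph.Subgraph.top_adj]
    have ha : ((e a : V)) ∈ (Q : Set V) := (e a).2
    have hb : ((e b : V)) ∈ (Q : Set V) := (e b).2
    constructor
    · rintro ⟨-, -, h⟩ rfl
      exact h.ne rfl
    · intro h
      exact ⟨ha, hb, hQ.isClique ha hb fun h' => h (e.injective (Subtype.ext h'))⟩

theorem copyCount_top_eq [Fintype V] [DecidableEq V] (G : SimpleGraph V) [DecidableRel G.Adj]
    (s : ℕ) : G.copyCount (⊤ : SimpleGraph (Fin s)) = #(G.cliqueFinset s) := by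
  rw [copyCount_top_eq_classical]
  congr!

/-- The Kruskal-Katona theorem for the numbers of cliques of a graph. -/
theorem choose_le_copyCount_of_le [Fintype V] (G : SimpleGraph V) {s t k : ℕ} (hst : s ≤ t)
    (htk : t ≤ k) (h : k.choose t ≤ G.copyCount (⊤ : SimpleGraph (Fin t))) :
    k.choose s ≤ G.copyCount (⊤ : SimpleGraph (Fin s)) := by
  rcases hst.eq_or_lt with rfl | hlt
  · exact h
  rw [copyCount_top_eq] at h ⊢
  let e := Fintype.equivFin V
  set G' := G.map e.toEmbedding with hG'
  have hc : ∀ r, #(G'.cliqueFinset r) = #(G.cliqueFinset r) := fun r => by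
    have := congrArg card (SimpleGraph.cliqueFinset_map_of_equiv G e r)
    rw [card_map] at this
    rw [← this]
    congr!
  have hkn : k ≤ Fintype.card V := by
    by_contra! hlt
    have h1 := h.trans (SimpleGraph.card_cliqueFinset_le (G := G) (n := t))
    have h2 : (Fintype.card V).choose t < k.choose t := by
      have h3 : (k - 1).choose t < k.choose t := by
        obtain ⟨k, rfl⟩ : ∃ k', k = k' + 1 := ⟨k - 1, by omega⟩
        obtain ⟨t, rfl⟩ : ∃ t', t = t' + 1 := ⟨t - 1, by omega⟩
        rw [Nat.choose_succ_succ', Nat.add_sub_cancel]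
        have := Nat.choose_pos (n := k) (k := t) (by omega)
        omega
      exact (Nat.choose_le_choose t (by omega)).trans_lt h3
    omega
  rw [← hc] at h ⊢
  have hsz : (↑(G'.cliqueFinset t) : Set (Finset (Fin (Fintype.card V)))).Sized t := by
    intro Q hQ
    exact (SimpleGraph.mem_cliqueFinset_iff.1 hQ).card_eq
  -- The `(t - s)`-fold shadow of the `t`-cliques consists of `s`-cliques.
  have h1 := kruskal_katona_lovasz_form (i := t - s) (by omega) htk hkn hsz h
  rw [show t - (t - s) = s by omega] at h1
  refine h1.trans (card_le_card fun Q hQ => ?_)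
  rw [mem_shadow_iterate_iff_exists_sdiff] at hQ
  obtain ⟨S, hS, hQS, hcard⟩ := hQ
  rw [SimpleGraph.mem_cliqueFinset_iff] at hS ⊢
  refine ⟨hS.isClique.subset (coe_subset.2 hQS), ?_⟩
  have := card_sdiff_of_subset hQS
  have h2 := card_le_card hQS
  have h3 := hS.card_eq
  omega

/-- In a triangle-free red graph neighbourhoods are blue cliques, so without a blue `K_t` all red
degrees are below `t`. A greedy choice then discards at most `t` vertices per step and finds a blue
`K_t` after all. -/
theorem isRamsey_top_of_sq_le [Fintype V] {t : ℕ} (h : t ^ 2 ≤ Fintype.card V) :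
    IsRamsey (⊤ : SimpleGraph V) 3 t := by
  intro R _
  by_contra! hcon
  obtain ⟨h3, ht⟩ := hcon
  rw [top_sdiff] at ht
  have hdeg : ∀ v, R.degree v < t := by
    intro v
    by_contra! hd
    obtain ⟨I, hI, hIc⟩ := exists_subset_card_eq hd
    refine ht I ⟨fun x hx y hy hne => ?_, hIc⟩
    rw [SimpleGraph.compl_adj]
    refine ⟨hne, fun hxy => ?_⟩
    have h1 := (SimpleGraph.mem_neighborFinset _ _ _).1 (hI hx)
    have h2 := (SimpleGraph.mem_neighborFinset _ _ _).1 (hI hy)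
    exact h3 _ (SimpleGraph.is3Clique_triple_iff.2 ⟨h1, h2, hxy⟩)
  have key : ∀ j ≤ t, ∀ S : Finset V, j * t ≤ #S → ∃ I ⊆ S, Rᶜ.IsNClique j I := by
    intro j
    induction j with
    | zero => exact fun _ S _ => ⟨∅, empty_subset _, by simp⟩
    | succ j ih =>
      intro hj S hS
      obtain ⟨v, hv⟩ : S.Nonempty := card_pos.1 (by nlinarith)
      obtain ⟨I, hIS, hI⟩ := ih (by omega) (S \ insert v (R.neighborFinset v)) (by
        have h1 := le_card_sdiff (insert v (R.neighborFinset v)) S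
        have h2 := card_insert_le v (R.neighborFinset v)
        rw [SimpleGraph.card_neighborFinset_eq_degree] at h2
        have := hdeg v
        rw [add_mul, one_mul] at hS
        omega)
      refine ⟨insert v I, insert_subset hv (hIS.trans sdiff_subset), hI.insert fun b hb => ?_⟩
      have hb' := Finset.mem_sdiff.1 (hIS hb)
      rw [mem_insert, SimpleGraph.mem_neighborFinset, not_or] at hb'
      exact (SimpleGraph.compl_adj _ _ _).2 ⟨fun e => hb'.2.1 e.symm, hb'.2.2⟩
  obtain ⟨I, -, hI⟩ := key t le_rfl univ (by rw [card_univ]; nlinarith)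
  exact ht I hI

theorem ramseyNumber_three_le (t : ℕ) : ramseyNumber 3 t ≤ t ^ 2 :=
  Nat.sInf_le (isRamsey_top_of_sq_le (by rw [Fintype.card_fin]))

theorem isRamsey_ramseyNumber (t : ℕ) :
    IsRamsey (⊤ : SimpleGraph (Fin (ramseyNumber 3 t))) 3 t :=
  Nat.sInf_mem (s := {n : ℕ | IsRamsey (⊤ : SimpleGraph (Fin n)) 3 t})
    ⟨t ^ 2, isRamsey_top_of_sq_le (by rw [Fintype.card_fin])⟩

theorem copyCount_pos_of_isRamsey [Fintype V] {G : SimpleGraph V} {t : ℕ}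
    (hG : IsRamsey G 3 t) : 0 < G.copyCount (⊤ : SimpleGraph (Fin t)) := by
  rw [copyCount_top_eq, card_pos, nonempty_iff_ne_empty, Ne, SimpleGraph.cliqueFinset_eq_empty_iff]
  rcases hG ⊥ bot_le with h | h
  · exact absurd (SimpleGraph.cliqueFree_bot (by norm_num)) h
  · rwa [sdiff_bot] at h

theorem copyCount_top_top (n s : ℕ) :
    (⊤ : SimpleGraph (Fin n)).copyCount (⊤ : SimpleGraph (Fin s)) = n.choose s := by
  rw [copyCount_top_eq]
  conv_rhs => rw [← Fintype.card_fin n, ← card_univ, ← card_powersetCard]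
  congr 1
  ext Q
  simp [SimpleGraph.mem_cliqueFinset_iff, SimpleGraph.isNClique_iff, mem_powersetCard]

theorem graphRamseyNumber_le (s t : ℕ) :
    graphRamseyNumber (⊤ : SimpleGraph (Fin s)) 3 t ≤ (ramseyNumber 3 t).choose s :=
  Nat.sInf_le ⟨_, _, isRamsey_ramseyNumber t, copyCount_top_top _ _⟩

theorem exists_graphRamseyNumber (s t : ℕ) : ∃ (n : ℕ) (G : SimpleGraph (Fin n)),
    IsRamsey G 3 t ∧ G.copyCount (⊤ : SimpleGraph (Fin s)) =
      graphRamseyNumber (⊤ : SimpleGraph (Fin s)) 3 t :=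
  Nat.sInf_mem (s := {N : ℕ | ∃ (n : ℕ) (G : SimpleGraph (Fin n)),
    IsRamsey G 3 t ∧ G.copyCount (⊤ : SimpleGraph (Fin s)) = N})
    ⟨_, _, _, isRamsey_ramseyNumber t, copyCount_top_top _ _⟩

theorem IsRamsey.comap_equiv {W : Type*} {G : SimpleGraph V} {a b : ℕ} (e : W ≃ V)
    (hG : IsRamsey G a b) : IsRamsey (G.comap e) a b := by
  intro R hR
  have hR' : R.comap e.symm ≤ G := fun x y h => by
    have := hR h
    simpa using this
  have key : ∀ (K : SimpleGraph V) (L : SimpleGraph W), (∀ x y, K.Adj x y → L.Adj (e.symm x)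
      (e.symm y)) → ∀ n, ¬ K.CliqueFree n → ¬ L.CliqueFree n := by
    intro K L h n hK hL
    refine hK fun s hs => hL (s.map e.symm.toEmbedding) ⟨?_, by rw [card_map, hs.card_eq]⟩
    intro x hx y hy hne
    simp only [coe_map, Set.mem_image, mem_coe] at hx hy
    obtain ⟨x, hx, rfl⟩ := hx
    obtain ⟨y, hy, rfl⟩ := hy
    exact h x y (hs.isClique hx hy fun e' => hne (by rw [e']))
  refine (hG _ hR').imp (key _ _ (fun x y h => h) _) (key _ _ (fun x y h => ?_) _)
  rw [SimpleGraph.sdiff_adj] at h ⊢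
  exact ⟨by simpa using h.1, h.2⟩

theorem graphRamseyNumber_le_copyCount [Fintype V] {G : SimpleGraph V} {t : ℕ} (s : ℕ)
    (hG : IsRamsey G 3 t) :
    graphRamseyNumber (⊤ : SimpleGraph (Fin s)) 3 t ≤
      G.copyCount (⊤ : SimpleGraph (Fin s)) := by
  let e := (Fintype.equivFin V).symm
  have h1 : graphRamseyNumber (⊤ : SimpleGraph (Fin s)) 3 t ≤
      (G.comap e).copyCount (⊤ : SimpleGraph (Fin s)) := Nat.sInf_le ⟨_, _, hG.comap_equiv e, rfl⟩
  rw [copyCount_top_eq] at h1 ⊢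
  refine h1.trans (card_le_card_of_injOn (fun Q => Q.map e.toEmbedding) ?_ ?_)
  · intro Q hQ
    rw [mem_coe, SimpleGraph.mem_cliqueFinset_iff] at hQ ⊢
    refine ⟨?_, by rw [card_map, hQ.card_eq]⟩
    intro x hx y hy hne
    simp only [coe_map, Set.mem_image, mem_coe] at hx hy
    obtain ⟨x, hx, rfl⟩ := hx
    obtain ⟨y, hy, rfl⟩ := hy
    exact hQ.isClique hx hy fun e' => hne (by rw [e'])
  · exact fun _ _ _ _ h => Finset.map_injective _ h

end Cliques

/-! ### Choice of parameters and the lower bound -/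

section LowerBound

open Finset

theorem eventually_log_sq_le {δ : ℝ} (hδ : 0 < δ) :
    ∀ᶠ t : ℕ in atTop, Real.log (t : ℝ) ^ 2 ≤ δ * t := by
  have h := (Real.isLittleO_pow_log_id_atTop (n := 2)).bound hδ
  filter_upwards [tendsto_natCast_atTop_atTop.eventually h] with t ht
  simpa using ht

theorem eventually_pow_le_two_pow :
    ∀ᶠ q : ℕ in atTop, (q ^ 3) ^ (40000 * q ^ 2) ≤ 2 ^ q ^ 3 := by
  have hδ : 0 < Real.log 2 / 120000 := by
    have := Real.log_pos one_lt_two; positivity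
  have h := Real.isLittleO_log_id_atTop.bound hδ
  filter_upwards [tendsto_natCast_atTop_atTop.eventually h, eventually_ge_atTop 1] with q hq hq1
  have hq0 : (0 : ℝ) < q := by exact_mod_cast hq1
  have h1 : Real.log q ≤ Real.log 2 / 120000 * q := by
    simpa using (le_abs_self _).trans hq
  have h2 : Real.log (((q : ℝ) ^ 3) ^ (40000 * q ^ 2)) ≤ Real.log (2 ^ q ^ 3) := by
    rw [Real.log_pow, Real.log_pow, Real.log_pow]
    push_cast
    have := mul_le_mul_of_nonneg_left h1 (by positivity : 0 ≤ 120000 * (q : ℝ) ^ 2)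
    linarith
  have h3 := (Real.log_le_log_iff (by positivity) (by positivity)).1 h2
  exact_mod_cast h3

theorem rpow_mul_log_bound {q t : ℝ} (hq : 2 ≤ q) (hqt : q * Real.log q ^ 2 ≤ t) :
    (q ^ 3 + 1) ^ (480000 * q * Real.log q) ≤ Real.exp (1920000 * t) := by
  have hq0 : 0 < q := by linarith
  have hl : 0 ≤ Real.log q := Real.log_nonneg (by linarith)
  have h1 : q ^ 3 + 1 ≤ q ^ 4 := by nlinarith [pow_pos hq0 3, sq_nonneg q]
  calc (q ^ 3 + 1) ^ (480000 * q * Real.log q)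
      ≤ (q ^ 4) ^ (480000 * q * Real.log q) :=
        Real.rpow_le_rpow (by positivity) h1 (by positivity)
    _ = Real.exp (1920000 * (q * Real.log q ^ 2)) := by
        rw [Real.rpow_def_of_pos (by positivity), Real.log_pow]
        congr 1
        push_cast
        ring
    _ ≤ _ := Real.exp_le_exp.2 (by linarith)

theorem pow_le_graphRamseyNumber {p t : ℕ} (hp : p.Prime)
    (hp2 : (p ^ 3) ^ (40000 * p ^ 2) ≤ 2 ^ p ^ 3)
    (hpt : (p : ℝ) * Real.log p ^ 2 ≤ t) :
    (Real.exp (-1920000) / 80000 * p) ^ t ≤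
      (graphRamseyNumber (⊤ : SimpleGraph (Fin t)) 3 t : ℝ) := by
  classical
  have : Fact p.Prime := ⟨hp⟩
  have hF : Fintype.card (ZMod p) = p := ZMod.card p
  obtain ⟨c, hc⟩ := exists_bipartition (F := ZMod p) (by rw [hF]; exact hp2)
  obtain ⟨n, G, hG, hGc⟩ := exists_graphRamseyNumber t t
  rw [copyCount_top_eq] at hGc
  have h1 := le_card_cliqueFinset_of_isRamsey (bipartitionGraph_cliqueFree c) hG
  have hp1 : (2 : ℝ) ≤ p := by exact_mod_cast hp.two_le
  have hp0 : (0 : ℝ) < p := by linarith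
  have hl : 0 ≤ Real.log p := Real.log_nonneg (by linarith)
  have hcard : Fintype.card (ZMod p × ZMod p × ZMod p) = p ^ 3 := by
    simp only [Fintype.card_prod, hF]; ring
  -- `θ` is chosen so that `exp (ε * θ / 2)` is exactly `p ^ 3`, the number of points.
  have h2 := card_indepTuples_le (bipartitionGraph c) (n₀ := 40000 * p ^ 2)
    (ε := 1 / (80000 * p)) (θ := 480000 * p * Real.log p) (by positivity) (by positivity)
    (by
      rw [hcard, show 1 / (80000 * (p : ℝ)) * (480000 * p * Real.log p) / 2 = 3 * Real.log p by
        field_simp; ring, mul_comm, Real.exp_mul, Real.exp_log hp0]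
      exact_mod_cast le_rfl)
    (fun U => by
      have := card_low_degree_lt c hc U
      rw [hF] at this
      convert this) t univ
  rw [card_univ, hcard, Nat.cast_pow] at h2
  have h3 : (#(indepTuples (bipartitionGraph c) t univ) : ℝ) ≤
      (80000 * p ^ 2 * Real.exp 1920000) ^ t := by
    refine h2.trans ?_
    rw [mul_pow (80000 * (p : ℝ) ^ 2), ← Real.exp_nat_mul, mul_comm (t : ℝ)]
    refine mul_le_mul (le_of_eq ?_) (rpow_mul_log_bound hp1 hpt) (by positivity) (by positivity)
    push_cast
    ring
  rw [hcard, hGc] at h1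
  set N := graphRamseyNumber (⊤ : SimpleGraph (Fin t)) 3 t
  have h4 : ((p : ℝ) ^ 3) ^ t ≤ N * (80000 * p ^ 2 * Real.exp 1920000) ^ t := by
    have h5 : (((p ^ 3) ^ t : ℕ) : ℝ) ≤
      ((N * #(indepTuples (bipartitionGraph c) t univ) : ℕ) : ℝ) := Nat.cast_le.2 h1
    push_cast at h5
    exact h5.trans (mul_le_mul_of_nonneg_left h3 (Nat.cast_nonneg _))
  rw [← div_le_iff₀ (by positivity), ← div_pow] at h4
  refine le_trans (le_of_eq ?_) h4
  congr 1
  rw [Real.exp_neg]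
  field_simp

theorem choose_le_pow_of_le {k t : ℕ} {y : ℝ} (ht : 1 ≤ t)
    (hk : (k : ℝ) ≤ y * t / Real.exp 1) : (k.choose t : ℝ) ≤ y ^ t := by
  have ht0 : (0 : ℝ) < t := by exact_mod_cast ht
  have h1 : (t : ℝ) ^ t / t.factorial ≤ Real.exp t :=
    Real.pow_div_factorial_le_exp t ht0.le t
  have hf : (0 : ℝ) < t.factorial := by exact_mod_cast t.factorial_pos
  have h3 : (t : ℝ) ^ t ≤ Real.exp 1 ^ t * t.factorial := by
    rw [← Real.exp_nat_mul, mul_one]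
    exact (div_le_iff₀ hf).1 h1
  have hy : 0 ≤ y := by
    have h4 : 0 ≤ y * t / Real.exp 1 := (Nat.cast_nonneg k).trans hk
    have h5 : 0 ≤ y * t := by
      rw [le_div_iff₀ (Real.exp_pos 1), zero_mul] at h4; exact h4
    exact nonneg_of_mul_nonneg_left h5 ht0
  calc (k.choose t : ℝ) ≤ (k : ℝ) ^ t / t.factorial := Nat.choose_le_pow_div t k
    _ ≤ (y * t / Real.exp 1) ^ t / t.factorial := by gcongr
    _ = y ^ t * ((t : ℝ) ^ t / (Real.exp 1 ^ t * t.factorial)) := by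
        rw [div_pow, mul_pow]; field_simp
    _ ≤ y ^ t * 1 := by
        refine mul_le_mul_of_nonneg_left ?_ (by positivity)
        rw [div_le_one (by positivity)]
        exact h3
    _ = y ^ t := mul_one _

theorem one_le_graphRamseyNumber {s t : ℕ} (hst : s ≤ t) :
    1 ≤ graphRamseyNumber (⊤ : SimpleGraph (Fin s)) 3 t := by
  obtain ⟨n, G, hG, hGc⟩ := exists_graphRamseyNumber s t
  rw [← hGc, ← Nat.choose_self s]
  have h := choose_le_copyCount_of_le G hst le_rfl
    (by rw [Nat.choose_self]; exact copyCount_pos_of_isRamsey hG)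
  rw [Nat.choose_self]
  exact (Nat.choose_pos hst).trans_le h

theorem choose_le_graphRamseyNumber_of_le {s t k : ℕ} (hst : s ≤ t) (htk : t ≤ k)
    (h : k.choose t ≤ graphRamseyNumber (⊤ : SimpleGraph (Fin t)) 3 t) :
    k.choose s ≤ graphRamseyNumber (⊤ : SimpleGraph (Fin s)) 3 t := by
  obtain ⟨n, G, hG, hGc⟩ := exists_graphRamseyNumber s t
  rw [← hGc]
  exact choose_le_copyCount_of_le G hst htk (h.trans (graphRamseyNumber_le_copyCount t hG))

theorem eventually_exists_choose_le_graphRamseyNumber :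
    ∃ c : ℝ, 0 < c ∧ ∀ᶠ t : ℕ in atTop, ∃ k : ℕ, t ≤ k ∧
      c * ((t : ℝ) ^ 2 / Real.log t ^ 2) ≤ k ∧
      k.choose t ≤ graphRamseyNumber (⊤ : SimpleGraph (Fin t)) 3 t := by
  set b : ℝ := Real.exp (-1920000) / 80000 with hb
  have hb0 : 0 < b := by positivity
  set e : ℝ := Real.exp 1 with he
  have he0 : 0 < e := Real.exp_pos 1
  have he1 : 1 ≤ e := Real.one_le_exp zero_le_one
  obtain ⟨q₀, hq₀⟩ := eventually_atTop.1 eventually_pow_le_two_pow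
  -- The three thresholds serve the union bound, `2 * t ≤ b * p * t / e` (hence `t ≤ k`, with room
  -- for the floor), and Bertrand's postulate.
  set A : ℝ := max (max q₀ (2 * e / b)) 1 with hA
  have hA1 : 1 ≤ A := le_max_right _ _
  have hA0 : 0 < A := by linarith
  refine ⟨b / (4 * e), by positivity, ?_⟩
  filter_upwards [eventually_log_sq_le (δ := 1 / (2 * A)) (by positivity),
    eventually_ge_atTop 3] with t ht ht2
  have ht2' : (3 : ℝ) ≤ t := by exact_mod_cast ht2
  have ht0 : (0 : ℝ) < t := by linarith
  have hL : 0 < Real.log t := Real.log_pos (by linarith)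
  have hL2 : 0 < Real.log t ^ 2 := by positivity
  set w : ℝ := (t : ℝ) / (2 * Real.log t ^ 2) with hw
  have hwA : A ≤ w := by
    rw [hw, le_div_iff₀ (by positivity)]
    have := mul_le_mul_of_nonneg_left ht (by positivity : 0 ≤ 2 * A)
    have e1 : 2 * A * (1 / (2 * A) * t) = t := by field_simp
    linarith
  have hw0 : 0 ≤ w := by linarith
  obtain ⟨p, hp, hp1, hp2⟩ := Nat.exists_prime_lt_and_le_two_mul ⌊w⌋₊
    (Nat.floor_pos.2 (hA1.trans hwA)).ne'
  have hpw : w < p := (Nat.lt_floor_add_one w).trans_le (by exact_mod_cast hp1)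
  have hpw2 : (p : ℝ) ≤ 2 * w := by
    have : (p : ℝ) ≤ 2 * ⌊w⌋₊ := by exact_mod_cast hp2
    linarith [Nat.floor_le hw0]
  have hpL : (p : ℝ) * Real.log t ^ 2 ≤ t := by
    have := mul_le_mul_of_nonneg_right hpw2 hL2.le
    have e1 : 2 * w * Real.log t ^ 2 = t := by rw [hw]; field_simp
    linarith
  have hp0 : (0 : ℝ) < p := by linarith
  have hp1' : (1 : ℝ) ≤ p := by linarith
  have hLt : (p : ℝ) ≤ t := by
    have h1 : 1 ≤ Real.log t := by
      rw [Real.le_log_iff_exp_le ht0]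
      linarith [Real.exp_one_lt_d9]
    have h2 := mul_le_mul_of_nonneg_left (one_le_pow₀ (n := 2) h1) hp0.le
    linarith
  have hpp : (p : ℝ) * Real.log p ^ 2 ≤ t := by
    refine le_trans (mul_le_mul_of_nonneg_left ?_ hp0.le) hpL
    exact pow_le_pow_left₀ (Real.log_nonneg hp1') (Real.log_le_log hp0 hLt) 2
  have hq : q₀ ≤ p := by
    have : (q₀ : ℝ) ≤ p := ((le_max_left _ _).trans (le_max_left _ _)).trans (hwA.trans hpw.le)
    exact_mod_cast this
  have hpb : 2 * e ≤ b * p := by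
    have : 2 * e / b ≤ p := ((le_max_right _ _).trans (le_max_left _ _)).trans (hwA.trans hpw.le)
    rw [div_le_iff₀ hb0] at this
    linarith
  have hmain := pow_le_graphRamseyNumber hp (hq₀ p hq) hpp
  have hx0 : 0 ≤ b * p * t / e := by positivity
  have hx2 : 2 * (t : ℝ) ≤ b * p * t / e := by
    rw [le_div_iff₀ he0]
    nlinarith
  refine ⟨⌊b * p * t / e⌋₊, Nat.le_floor (by linarith), ?_, ?_⟩
  · have h1 := Nat.lt_floor_add_one (b * p * t / e)
    have h2 : b / (4 * e) * ((t : ℝ) ^ 2 / Real.log t ^ 2) ≤ b * p * t / e / 2 := by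
      have : b / (4 * e) * ((t : ℝ) ^ 2 / Real.log t ^ 2) = b * w * t / e / 2 := by
        rw [hw]; field_simp; ring
      rw [this]
      gcongr
    linarith
  · have h1 := choose_le_pow_of_le (y := b * p) (by omega) (Nat.floor_le hx0)
    exact_mod_cast h1.trans hmain

theorem exists_choose_le_graphRamseyNumber :
    ∃ c : ℝ, 0 < c ∧ ∀ t : ℕ, 2 ≤ t → ∃ k : ℕ, t ≤ k ∧
      c * ((t : ℝ) ^ 2 / Real.log t ^ 2) ≤ k ∧
      k.choose t ≤ graphRamseyNumber (⊤ : SimpleGraph (Fin t)) 3 t := by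
  obtain ⟨c, hc, h⟩ := eventually_exists_choose_le_graphRamseyNumber
  obtain ⟨T, hT⟩ := eventually_atTop.1 h
  have hl2 : 0 < Real.log 2 := Real.log_pos one_lt_two
  refine ⟨min c (Real.log 2 ^ 2 / (T + 1)), lt_min hc (by positivity), fun t ht => ?_⟩
  have ht' : (2 : ℝ) ≤ t := by exact_mod_cast ht
  have hL : 0 < Real.log t := Real.log_pos (by linarith)
  rcases le_or_gt T t with hTt | hTt
  · obtain ⟨k, h1, h2, h3⟩ := hT t hTt
    exact ⟨k, h1, (mul_le_mul_of_nonneg_right (min_le_left _ _) (by positivity)).trans h2, h3⟩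
  -- For the finitely many small `t`, `k = t` works because `t.choose t = 1`; the constant is
  -- lowered to allow it.
  · refine ⟨t, le_rfl, ?_, by rw [Nat.choose_self]; exact one_le_graphRamseyNumber le_rfl⟩
    have hTt' : (t : ℝ) ≤ T + 1 := by
      have : (t : ℝ) < T := by exact_mod_cast hTt
      linarith
    have hll : Real.log 2 ^ 2 ≤ Real.log t ^ 2 :=
      pow_le_pow_left₀ hl2.le (Real.log_le_log two_pos ht') 2
    calc _ ≤ Real.log 2 ^ 2 / (T + 1) * ((t : ℝ) ^ 2 / Real.log t ^ 2) :=
          mul_le_mul_of_nonneg_right (min_le_right _ _) (by positivity)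
      _ = (t * t * Real.log 2 ^ 2) / ((T + 1) * Real.log t ^ 2) := by field_simp
      _ ≤ t := by
          rw [div_le_iff₀ (by positivity)]
          have := mul_le_mul hTt' hll (by positivity) (by positivity)
          nlinarith

end LowerBound

/-! ### Binomial coefficients of real numbers -/

section RealChoose

open Finset

theorem realChoose_natCast {k s : ℕ} (h : s ≤ k) : realChoose (k : ℝ) s = k.choose s := by
  have hf : (s.factorial : ℝ) ≠ 0 := by exact_mod_cast s.factorial_ne_zero
  rw [realChoose, div_eq_iff hf]
  have h1 : ((k.descFactorial s : ℕ) : ℝ) = ∏ i ∈ range s, ((k : ℝ) - i) := by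
    rw [Nat.descFactorial_eq_prod_range, Nat.cast_prod]
    refine prod_congr rfl fun i hi => ?_
    rw [Nat.cast_sub ((mem_range.1 hi).le.trans h)]
  rw [← h1, Nat.descFactorial_eq_factorial_mul_choose]
  push_cast
  ring

theorem continuous_realChoose (s : ℕ) : Continuous fun x => realChoose x s := by
  unfold realChoose
  fun_prop

theorem succ_le_choose (s N : ℕ) : N + 1 ≤ (s + N + 1).choose (s + 1) := by
  induction N with
  | zero => simp
  | succ N ih =>
    rw [← add_assoc, Nat.choose_succ_succ' (s + N + 1) s]
    have := Nat.choose_pos (n := s + N + 1) (k := s) (by omega)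
    omega

/-- Intermediate value theorem on `[k, k + N]`. It needs `s ≠ 0`, since `realChoose x 0` is
constant. -/
theorem exists_realChoose_eq {k s N : ℕ} (hs : s ≠ 0) (hsk : s ≤ k) (h : k.choose s ≤ N) :
    ∃ x : ℝ, (k : ℝ) ≤ x ∧ realChoose x s = N := by
  have h1 : N ≤ (k + N).choose s := by
    obtain ⟨s, rfl⟩ := Nat.exists_eq_succ_of_ne_zero hs
    calc N ≤ (s + N + 1).choose (s + 1) := (Nat.le_succ N).trans (succ_le_choose s N)
      _ ≤ _ := Nat.choose_le_choose _ (by omega)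
  have h2 := intermediate_value_Icc (a := (k : ℝ)) (b := ((k + N : ℕ) : ℝ))
    (by push_cast; linarith [Nat.cast_nonneg (α := ℝ) N]) (continuous_realChoose s).continuousOn
  have h3 : (N : ℝ) ∈ Set.Icc (realChoose (k : ℝ) s) (realChoose ((k + N : ℕ) : ℝ) s) := by
    rw [realChoose_natCast hsk, realChoose_natCast (by omega)]
    exact ⟨by exact_mod_cast h, by exact_mod_cast h1⟩
  obtain ⟨x, hx, hxN⟩ := h2 h3
  exact ⟨x, hx.1, hxN⟩

theorem graphRamseyNumber_zero (t : ℕ) :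
    graphRamseyNumber (⊤ : SimpleGraph (Fin 0)) 3 t = 1 := by
  obtain ⟨n, G, -, hGc⟩ := exists_graphRamseyNumber 0 t
  rw [← hGc, SimpleGraph.copyCount_of_isEmpty]

end RealChoose

/-! ### The exponent `1 - o(1)` -/

section Exponent

theorem exists_exponent (s t : ℕ) (hst : s ≤ t) : ∃ ε : ℝ,
    (graphRamseyNumber (⊤ : SimpleGraph (Fin s)) 3 t : ℝ) =
      (((ramseyNumber 3 t).choose s : ℕ) : ℝ) ^ (1 - ε) ∧
    ((s = 0 ∧ ε = 0) ∨ ε = (Real.log ((ramseyNumber 3 t).choose s : ℕ) -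
      Real.log (graphRamseyNumber (⊤ : SimpleGraph (Fin s)) 3 t)) /
        Real.log ((ramseyNumber 3 t).choose s : ℕ)) := by
  rcases Nat.eq_zero_or_pos s with rfl | hs
  · exact ⟨0, by rw [graphRamseyNumber_zero]; simp, Or.inl ⟨rfl, rfl⟩⟩
  refine ⟨_, ?_, Or.inr rfl⟩
  have h1 := one_le_graphRamseyNumber hst
  have h2 := graphRamseyNumber_le s t
  set N := graphRamseyNumber (⊤ : SimpleGraph (Fin s)) 3 t
  set C := (ramseyNumber 3 t).choose s
  have hN : (0 : ℝ) < N := by exact_mod_cast h1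
  have hC : (0 : ℝ) < C := by exact_mod_cast h1.trans h2
  rcases Nat.eq_or_lt_of_le (h1.trans h2) with hC1 | hC1
  · have hN1 : N = 1 := by omega
    rw [hN1, ← hC1]
    simp
  · have hl : Real.log C ≠ 0 := (Real.log_pos (by exact_mod_cast hC1)).ne'
    rw [Real.rpow_def_of_pos hC, mul_sub, mul_div_cancel₀ _ hl, mul_one, sub_sub_cancel,
      Real.exp_log hN]

/-- Bounding both binomials by powers over `s!` makes `s!` cancel in the numerator; in the
denominator `s! ≤ t ^ s`. Both are then multiples of `s`, so the quotient is uniform in `s`. The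
condition `2 * t < k` gives `k + 1 - s ≥ k / 2` and a positive denominator. -/
theorem exponent_bound {s t k r N : ℕ} (hs : 1 ≤ s) (hst : s ≤ t) (hk : 2 * t < k)
    (hkN : k.choose s ≤ N) (hNr : N ≤ r.choose s) :
    |(Real.log (r.choose s : ℕ) - Real.log N) / Real.log (r.choose s : ℕ)| ≤
      Real.log (2 * r / k) / Real.log (k / (2 * t)) := by
  have ht0 : (0 : ℝ) < t := by exact_mod_cast (by omega : 0 < t)
  have hs0 : (0 : ℝ) < s := by exact_mod_cast hs
  have hk0 : (0 : ℝ) < k := by exact_mod_cast (by omega : 0 < k)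
  have hktr : 2 * (t : ℝ) < k := by exact_mod_cast hk
  have hf : (0 : ℝ) < s.factorial := by exact_mod_cast s.factorial_pos
  have hkc : 0 < k.choose s := Nat.choose_pos (by omega)
  have hN0 : (0 : ℝ) < N := by exact_mod_cast hkc.trans_le hkN
  have hC0 : (0 : ℝ) < (r.choose s : ℕ) := by exact_mod_cast (hkc.trans_le hkN).trans_le hNr
  have hr0 : (0 : ℝ) < r := by
    rcases Nat.eq_zero_or_pos r with rfl | h
    · rw [Nat.choose_eq_zero_of_lt (by omega)] at hNr; omega
    · exact_mod_cast h
  have hNC : Real.log N ≤ Real.log (r.choose s : ℕ) :=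
    Real.log_le_log hN0 (by exact_mod_cast hNr)
  have hN1 : ((k : ℝ) / 2) ^ s / s.factorial ≤ N := by
    have h1 : (((k + 1 - s : ℕ) : ℝ) ^ s) / s.factorial ≤ k.choose s := Nat.pow_le_choose s k
    have h2 : (k : ℝ) / 2 ≤ ((k + 1 - s : ℕ) : ℝ) := by
      rw [Nat.cast_sub (by omega)]
      have : (s : ℝ) ≤ t := by exact_mod_cast hst
      push_cast
      linarith
    calc ((k : ℝ) / 2) ^ s / s.factorial ≤ (((k + 1 - s : ℕ) : ℝ) ^ s) / s.factorial := by
          gcongr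
      _ ≤ k.choose s := h1
      _ ≤ N := by exact_mod_cast hkN
  have hlogN : s * Real.log (k / 2) - Real.log s.factorial ≤ Real.log N := by
    rw [← Real.log_pow, ← Real.log_div (by positivity) hf.ne']
    exact Real.log_le_log (by positivity) hN1
  have hlogC : Real.log (r.choose s : ℕ) ≤ s * Real.log r - Real.log s.factorial := by
    rw [← Real.log_pow, ← Real.log_div (by positivity) hf.ne']
    exact Real.log_le_log hC0 (Nat.choose_le_pow_div s r)
  have hfac : Real.log s.factorial ≤ s * Real.log t := by
    rw [← Real.log_pow]
    refine Real.log_le_log hf ?_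
    exact_mod_cast (Nat.factorial_le_pow s).trans (Nat.pow_le_pow_left hst s)
  have e1 : Real.log (2 * r / k) = Real.log r - Real.log (k / 2) := by
    rw [← Real.log_div hr0.ne' (by positivity)]
    congr 1
    field_simp
  have e2 : Real.log (k / (2 * t)) = Real.log (k / 2) - Real.log t := by
    rw [← Real.log_div (by positivity) ht0.ne']
    congr 1
    field_simp
  have hpos : 0 < Real.log (k / (2 * t)) := by
    refine Real.log_pos ?_
    rw [one_lt_div (by positivity)]
    exact hktr
  have hden : s * Real.log (k / (2 * t)) ≤ Real.log (r.choose s : ℕ) := by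
    rw [e2]; linarith
  have hnum : Real.log (r.choose s : ℕ) - Real.log N ≤ s * Real.log (2 * r / k) := by
    rw [e1]; linarith
  have hdpos : 0 < s * Real.log (k / (2 * t)) := by positivity
  rw [abs_of_nonneg (div_nonneg (by linarith) (by linarith)),
    ← mul_div_mul_left (Real.log (2 * r / k)) _ hs0.ne']
  exact div_le_div₀ (by linarith) hnum hdpos hden

/-- The bound on the exponent's deviation from one tends to zero. -/
theorem tendsto_exponent_bound {c : ℝ} (hc : 0 < c) :
    Tendsto (fun t : ℕ => Real.log (2 * Real.log t ^ 2 / c) /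
      Real.log (c * t / (2 * Real.log t ^ 2))) atTop (𝓝 0) := by
  have hlog : Tendsto (fun x : ℝ => Real.log x / x) atTop (𝓝 0) :=
    Real.isLittleO_log_id_atTop.tendsto_div_nhds_zero
  have hinv : ∀ a : ℝ, Tendsto (fun x : ℝ => a / x) atTop (𝓝 0) := fun a =>
    tendsto_const_nhds.div_atTop tendsto_id
  have h1 : Tendsto (fun x : ℝ => Real.log (2 / c) / x + 2 * (Real.log x / x)) atTop (𝓝 0) := by
    simpa using (hinv _).add (hlog.const_mul 2)
  have h2 : Tendsto (fun x : ℝ => 1 + Real.log (c / 2) / x - 2 * (Real.log x / x)) atTop (𝓝 1) := by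
    simpa using ((hinv _).const_add 1).sub (hlog.const_mul 2)
  have h3 := (h1.div h2 one_ne_zero).comp
    (Real.tendsto_log_atTop.comp tendsto_natCast_atTop_atTop)
  rw [zero_div] at h3
  refine h3.congr' ?_
  filter_upwards [eventually_ge_atTop 2] with t ht
  have ht' : (2 : ℝ) ≤ t := by exact_mod_cast ht
  have ht0 : (0 : ℝ) < t := by linarith
  have hL : 0 < Real.log t := Real.log_pos (by linarith)
  simp only [Function.comp_apply, Pi.div_apply]
  set L := Real.log t with hLdef
  have e1 : Real.log (2 * L ^ 2 / c) = L * (Real.log (2 / c) / L + 2 * (Real.log L / L)) := by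
    rw [mul_div_right_comm, Real.log_mul (by positivity) (by positivity), Real.log_pow]
    field_simp
    push_cast
    ring
  have e2 : Real.log (c * t / (2 * L ^ 2)) =
      L * (1 + Real.log (c / 2) / L - 2 * (Real.log L / L)) := by
    rw [show c * t / (2 * L ^ 2) = c / 2 * t / L ^ 2 by field_simp,
      Real.log_div (by positivity) (by positivity), Real.log_mul (by positivity) (by positivity),
      Real.log_pow, ← hLdef]
    field_simp
    push_cast
    ring
  rw [e1, e2, mul_div_mul_left _ _ hL.ne']

end Exponent

theorem mainTheorem2 :
    (∃ c : ℝ, 0 < c ∧ ∀ s t : ℕ, 2 ≤ t → s ≤ t →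
      ∃ x : ℝ, c * ((t : ℝ) ^ 2 / Real.log (t : ℝ) ^ 2) ≤ x ∧ (s : ℝ) ≤ x ∧
        (∀ (V : Type*) [Fintype V] (G : SimpleGraph V), IsRamsey G 3 t →
          realChoose x s ≤ (G.copyCount (⊤ : SimpleGraph (Fin s)) : ℝ)) ∧
        (graphRamseyNumber (⊤ : SimpleGraph (Fin s)) 3 t : ℝ) = realChoose x s) ∧
    (∃ δ : ℕ → ℝ, Tendsto δ atTop (𝓝 0) ∧ ∀ s t : ℕ, s ≤ t →
      ∃ ε : ℝ, |ε| ≤ δ t ∧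
        (graphRamseyNumber (⊤ : SimpleGraph (Fin s)) 3 t : ℝ) =
          (((ramseyNumber 3 t).choose s : ℕ) : ℝ) ^ (1 - ε)) := by
  obtain ⟨c, hc, hk⟩ := exists_choose_le_graphRamseyNumber
  refine ⟨⟨c, hc, fun s t ht hst => ?_⟩, ?_⟩
  · obtain ⟨k, htk, hck, hkN⟩ := hk t ht
    have h1 := choose_le_graphRamseyNumber_of_le hst htk hkN
    obtain ⟨x, hkx, hx⟩ : ∃ x : ℝ, (k : ℝ) ≤ x ∧
        realChoose x s = (graphRamseyNumber (⊤ : SimpleGraph (Fin s)) 3 t : ℝ) := by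
      rcases eq_or_ne s 0 with rfl | hs
      · exact ⟨k, le_rfl, by rw [graphRamseyNumber_zero]; simp [realChoose]⟩
      · exact exists_realChoose_eq hs (hst.trans htk) h1
    have hsk : (s : ℝ) ≤ k := by exact_mod_cast hst.trans htk
    refine ⟨x, hck.trans hkx, hsk.trans hkx, fun V _ G hG => ?_, hx.symm⟩
    rw [hx]
    exact_mod_cast graphRamseyNumber_le_copyCount s hG
  · have hex : ∀ t s : ℕ, ∃ ε : ℝ, s ≤ t → (graphRamseyNumber (⊤ : SimpleGraph (Fin s)) 3 t : ℝ) =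
        (((ramseyNumber 3 t).choose s : ℕ) : ℝ) ^ (1 - ε) ∧
        ((s = 0 ∧ ε = 0) ∨ ε = (Real.log ((ramseyNumber 3 t).choose s : ℕ) -
          Real.log (graphRamseyNumber (⊤ : SimpleGraph (Fin s)) 3 t)) /
            Real.log ((ramseyNumber 3 t).choose s : ℕ)) := fun t s => by
      by_cases hst : s ≤ t
      · obtain ⟨ε, h⟩ := exists_exponent s t hst
        exact ⟨ε, fun _ => h⟩
      · exact ⟨0, fun h => absurd h hst⟩
    choose ε hε using hex
    -- Taking `δ t` to be the exact maximum over `s ≤ t` settles small `t`; only its limit needs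
    -- estimates.
    refine ⟨fun t => (Finset.range (t + 1)).sup' ⟨0, by simp⟩ fun s => |ε t s|, ?_, fun s t hst =>
      ⟨ε t s, Finset.le_sup' (fun s => |ε t s|) (Finset.mem_range_succ_iff.2 hst), (hε t s hst).1⟩⟩
    refine squeeze_zero' (Eventually.of_forall fun t => ?_) ?_ (tendsto_exponent_bound hc)
    · exact (abs_nonneg _).trans (Finset.le_sup' (fun s => |ε t s|)
        (Finset.mem_range_succ_iff.2 (Nat.zero_le t)))
    filter_upwards [eventually_log_sq_le (δ := min (c / 4) (1 / 2)) (by positivity),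
      eventually_ge_atTop 3] with t ht ht3
    have ht3' : (3 : ℝ) ≤ t := by exact_mod_cast ht3
    have ht0 : (0 : ℝ) < t := by linarith
    have hL : 0 < Real.log t := Real.log_pos (by linarith)
    have hL2 : 0 < Real.log t ^ 2 := by positivity
    have ht4 : 4 * Real.log t ^ 2 ≤ c * t := by
      have := mul_le_mul_of_nonneg_right (min_le_left (c / 4) (1 / 2)) ht0.le
      linarith
    obtain ⟨k, htk, hck, hkN⟩ := hk t (by omega)
    have hk4 : 4 * (t : ℝ) ≤ k := by
      refine le_trans ?_ hck
      rw [mul_div_assoc', le_div_iff₀ hL2]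
      nlinarith
    have hk2 : 2 * t < k := by
      have : 2 * (t : ℝ) < k := by linarith
      exact_mod_cast this
    have hk0 : (0 : ℝ) < k := by linarith
    have hr : ((ramseyNumber 3 t : ℕ) : ℝ) ≤ (t : ℝ) ^ 2 := by
      exact_mod_cast ramseyNumber_three_le t
    have hx1 : 2 * (ramseyNumber 3 t : ℝ) / k ≤ 2 * Real.log t ^ 2 / c := by
      rw [div_le_div_iff₀ hk0 hc]
      rw [mul_div_assoc', div_le_iff₀ hL2] at hck
      nlinarith
    have hx2 : c * t / (2 * Real.log t ^ 2) ≤ k / (2 * t) := by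
      rw [div_le_div_iff₀ (by positivity) (by positivity)]
      rw [mul_div_assoc', div_le_iff₀ hL2] at hck
      nlinarith
    have hx3 : 1 < c * t / (2 * Real.log t ^ 2) := by
      rw [one_lt_div (by positivity)]
      linarith
    have hbound : ∀ s, 1 ≤ s → s ≤ t → |ε t s| ≤ Real.log (2 * Real.log t ^ 2 / c) /
        Real.log (c * t / (2 * Real.log t ^ 2)) := by
      intro s hs hst
      have h1 := exponent_bound hs hst hk2 (choose_le_graphRamseyNumber_of_le hst htk hkN)
        (graphRamseyNumber_le s t)
      rcases (hε t s hst).2 with h | h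
      · omega
      rw [h]
      have hden := Real.log_pos (hx3.trans_le hx2)
      -- The sign is read off from `h1`: the quotient bounds an absolute value and its denominator
      -- is positive.
      have hnum : 0 ≤ Real.log (2 * (ramseyNumber 3 t : ℝ) / k) := by
        have := (abs_nonneg _).trans h1
        rwa [le_div_iff₀ hden, zero_mul] at this
      have hrpos : (0 : ℝ) < ramseyNumber 3 t := by
        have h2 := (one_le_graphRamseyNumber hst).trans (graphRamseyNumber_le s t)
        rcases Nat.eq_zero_or_pos (ramseyNumber 3 t) with h0 | h0
        · rw [h0, Nat.choose_eq_zero_of_lt (by omega)] at h2; omega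
        · exact_mod_cast h0
      have hnum2 := Real.log_le_log (by positivity) hx1
      exact h1.trans (div_le_div₀ (hnum.trans hnum2) hnum2 (Real.log_pos hx3)
        (Real.log_le_log (by linarith) hx2))
    refine Finset.sup'_le _ _ fun s hs => ?_
    have hst : s ≤ t := Finset.mem_range_succ_iff.1 hs
    rcases Nat.eq_zero_or_pos s with rfl | hs
    · rcases (hε t 0 hst).2 with h | h
      · rw [h.2, abs_zero]
        exact (abs_nonneg _).trans (hbound 1 le_rfl (by omega))
      · rw [h]
        simp only [Nat.choose_zero_right, Nat.cast_one, Real.log_one, div_zero, abs_zero]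
        exact (abs_nonneg _).trans (hbound 1 le_rfl (by omega))
    · exact hbound s hs hst
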